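/- **Conventions.** C*-algebras and *-morphisms are unital; $\mathfrak{sa}(A)$ and $\mathscr S(A)$ denote the self-adjoint part and the state space of $A$; seminorms defined on a subspace take the value $\infty$ outside their domain. For a seminorm $N$ put $\mathrm{mk}_N(f,g)=\sup\{|f(x)-g(x)|:N(x)\le 1\}$ and let $\mathrm{Haus}_d$ be the Hausdorff distance for $d$. Constants $F,G\ge 1$, $H\ge 2$, $K\ge 0$ are fixed. *Quantum compact metric spaces.* $(A,L)$ is an $(F,K)$-quantum compact metric space if $L$ is a seminorm on a dense real subspace of $\mathfrak{sa}(A)$ with $L(1)=0$, $\mathrm{mk}_L$ is a metric on $\mathscr S(A)$ inducing the weak* topology, $\max\{L(\Re(ab)),L(\Im(ab))\}\le F(L(a)\|b\|+\|a\|L(b))+KL(a)L(b)$ for $a,b\in\operatorname{dom}L$, and $\{L\le 1\}$ is closed. *Metrical C*-correspondences.* An $(F,K,G,H)$-metrical C*-correspondence $(M,T,A,L,B,S)$ consists of $(F,K)$-quantum compact metric spaces $(A,L)$, $(B,S)$, a right Hilbert $B$-module $M$ on which $A$ acts through a unital *-morphism by adjointable operators, and a norm $T\ge\|\cdot\|_M$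 on a dense complex subspace of $M$ with $\{T\le1\}$ compact, such that $T(a\omega)\le G(\|a\|+L(a))T(\omega)$ and $\max\{S(\Re\langle\omega,\eta\rangle),S(\Im\langle\omega,\eta\rangle)\}\le H\,T(\omega)T(\eta)$ on the domains. A modular quantum isometry $(\Pi,\pi,\theta)$ between two such objects is a continuous linear map of the modules and two unital *-morphisms of the left and right algebras, compatible with both actions and with the inner products, mapping domains into domains, such that each of the three (semi)norms of the codomain is, on its domain, the quotient (infimum over preimages) of the corresponding one. A tunnel $\tau$ from $\mathbb M_1$ to $\mathbb M_2$ is an $(F,K,G,H)$-metrical C*-correspondence $\mathbb P=(P,T,\mathfrak D,L_{\mathfrak D},\mathfrak E,S_{\mathfrak E})$ with modular quantum isometries $(\Pi_j,\pi_j,\theta_j):\mathbb P\to\mathbb M_j$, $j=1,2$. Its extent is the maximum over $j$ of $\mathrm{Haus}_{\mathrm{mk}_{L_{\mathfrak D}}}(\{\varphi\circ\pi_j:\varphi\in\mathscr S(A_j)\},\mathscr S(\mathfrak D))$ and $\mathrm{Haus}_{\mathrm{mk}_{S_{\mathfrak E}}}(\{\psi\circ\theta_j:\psi\in\mathscr S(B_j)\},\mathscr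 S(\mathfrak E))$. *Metric spectral triples.* A spectral triple $(A,\mathcal H,D)$ is a unital C*-algebra $A$ with a unital *-representation on a Hilbert space $\mathcal H$ and a self-adjoint operator $D$ on $\mathcal H$ such that $D+i$ has a compact inverse and $\operatorname{dom}L_D=\{a\in\mathfrak{sa}(A):a\operatorname{dom}D\subseteq\operatorname{dom}D,\ [D,a]\text{ bounded}\}$ is dense in $\mathfrak{sa}(A)$. It is metric if $(A,L_D)$, with $L_D(a)=\|[D,a]\|$, is a quantum compact metric space. It defines the metrical C*-correspondence $(\mathcal H,\mathsf D,A,L_D,\mathbb C,0)$ with $\mathsf D(\xi)=\|\xi\|+\|D\xi\|$, and tunnels between metric spectral triples are tunnels between these. *Spectral propinquity.* For $\varepsilon>0$, an $\varepsilon$-iso-iso is a pair of maps $\varsigma_1,\varsigma_2:[0,\infty)\to[0,\infty)$ vanishing at $0$ with $\big||\varsigma_j(x)+\varsigma_j(y)-z|-|x+y-\varsigma_k(z)|\big|<\varepsilon$ for $x,y,z\in[0,1/\varepsilon]$ and $\{j,k\}=\{1,2\}$. For a tunnel $\tau$ from $(A_1,\mathcal H_1,D_1)$ to $(A_2,\mathcal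 H_2,D_2)$, with $U_j^t=\exp(itD_j)$, the $\varepsilon$-reach is $$\max_{\{j,k\}=\{1,2\}}\ \sup_{\mathsf D_j(\xi)\le1}\ \inf_{\mathsf D_k(\eta)\le1}\ \sup_{0\le t\le1/\varepsilon}\ \sup_{T(\omega)\le1}\Big|\langle U_j^{-t}\xi,\Pi_j(\omega)\rangle-\langle U_k^{-\varsigma_j(t)}\eta,\Pi_k(\omega)\rangle\Big|,$$ and the $\varepsilon$-magnitude is the maximum of the extent and the $\varepsilon$-reach. The spectral propinquity of two metric spectral triples is the infimum of $\{\sqrt2/2\}$ together with all $\varepsilon>0$ for which some tunnel and some $\varepsilon$-iso-iso have $\varepsilon$-magnitude $<\varepsilon$. **Theorem.** Let $(A_n,\mathcal H_n,D_n)_{n\in\mathbb N}$ be a sequence of metric spectral triples converging, for the spectral propinquity, to a metric spectral triple $(A_\infty,\mathcal H_\infty,D_\infty)$. Let $\lambda\in\mathbb R$ belong to the spectrum $\mathrm{Sp}(D_\infty)$, and suppose that there are $\delta>0$ and $N\in\mathbb N$ such that, for all $n\ge N$, the set $\mathrm{Sp}(D_n)\cap(\lambda-\delta,\lambda+\delta)$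 is a singleton $\{\lambda_n\}$. Let $\mathrm{mult}(\mu\,|\,D)$ denote the dimension of the eigenspace of $D$ for $\mu$. If the sequence $(\mathrm{mult}(\lambda_n\,|\,D_n))_n$ is eventually constant, then $$\lim_{n\to\infty}\mathrm{mult}(\lambda_n\,|\,D_n)=\mathrm{mult}(\lambda\,|\,D_\infty).$$ -/

import Mathlib

open Filter Topology
open scoped ENNReal NNReal ComplexOrder MulOpposite ComplexStarModule

universe w u v

noncomputable section

namespace SpectralPropinquity

/-! ### Distances between functionals and Hausdorff distances -/

/-- The Monge-Kantorovich distance `sup { |f x - g x| : N x ≤ 1 }` between two functionals, for the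
gauge `N` (with value `∞` outside its domain). -/
def mkDist {E : Type*} (N : E → ℝ≥0∞) (f g : E → ℂ) : ℝ≥0∞ :=
  ⨆ x : {x : E // N x ≤ 1}, ‖f x - g x‖ₑ

/-- The Monge-Kantorovich distance between two families of functionals with the same indices. -/
def mkFamilyDist {J E : Type*} (N : E → ℝ≥0∞) (f g : J → E → ℂ) : ℝ≥0∞ :=
  ⨆ j : J, mkDist N (f j) (g j)

/-- `sup_{x ∈ A} inf_{y ∈ B} d x y`. -/
def oneSidedHaus {X : Type*} (d : X → X → ℝ≥0∞) (A B : Set X) : ℝ≥0∞ :=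
  ⨆ x ∈ A, ⨅ y ∈ B, d x y

/-- The Hausdorff distance for `d`. -/
def haus {X : Type*} (d : X → X → ℝ≥0∞) (A B : Set X) : ℝ≥0∞ :=
  max (oneSidedHaus d A B) (oneSidedHaus d B A)

/-! ### Quantum compact metric spaces -/

/-- The state space of a unital C*-algebra, inside its dual with the weak* topology. -/
def stateSpace (A : Type*) [CStarAlgebra A] : Set (WeakDual ℂ A) :=
  {φ | φ 1 = 1 ∧ ∀ a : A, 0 ≤ φ (star a * a)}

/-- `(A, L)` is an `(F, K)`-quantum compact metric space. The seminorm is extended by `∞` outside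
its domain `{a | L a < ∞}`, which is a dense real subspace of the self-adjoint elements. -/
structure IsQCMS (F K : ℝ≥0) {A : Type*} [CStarAlgebra A] (L : A → ℝ≥0∞) : Prop where
  isSelfAdjoint : ∀ a, L a < ∞ → IsSelfAdjoint a
  add_le : ∀ a b, L (a + b) ≤ L a + L b
  smul_eq : ∀ (r : ℝ) (a : A), L (r • a) = ‖r‖ₑ * L a
  dense_dom : ∀ a : A, IsSelfAdjoint a → a ∈ closure {b | L b < ∞}
  one : L 1 = 0
  dist_lt_top : ∀ φ ∈ stateSpace A, ∀ ψ ∈ stateSpace A, mkDist L φ ψ < ∞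
  eq_of_dist_eq_zero : ∀ φ ∈ stateSpace A, ∀ ψ ∈ stateSpace A, mkDist L φ ψ = 0 → φ = ψ
  /-- The topology of the Monge-Kantorovich metric is the weak* topology. -/
  nhds_basis : ∀ φ : stateSpace A, (𝓝 φ).HasBasis (fun ε : ℝ≥0∞ => 0 < ε)
    (fun ε => {ψ | mkDist L (φ : WeakDual ℂ A) (ψ : WeakDual ℂ A) < ε})
  leibniz : ∀ a b : A, L a < ∞ → L b < ∞ →
    max (L (ℜ (a * b) : A)) (L (ℑ (a * b) : A)) ≤
      F * (L a * ‖b‖ₑ + ‖a‖ₑ * L b) + K * L a * L b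
  isClosed_ball : IsClosed {a | L a ≤ 1}

/-! ### Metrical C*-correspondences -/

/-- An `A`-`B` C*-correspondence `M` over unital C*-algebras, together with three extended gauges
`L` on `A`, `S` on `B` and `DN` on `M`. The right action of `B` is the action of `Bᵐᵒᵖ`, the
`B`-valued inner product is linear in its second variable, and `A` acts on the left, through a
unital *-morphism, by adjoinable operators. -/
structure CorrData.{a, b, m} where
  A : Type a
  B : Type b
  M : Type m
  [cstarA : CStarAlgebra A]
  [cstarB : CStarAlgebra B]
  [orderB : PartialOrder B]
  [starOrderB : StarOrderedRing B]
  [normM : NormedAddCommGroup M]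
  [spaceM : NormedSpace ℂ M]
  [rightM : Module Bᵐᵒᵖ M]
  [completeM : CompleteSpace M]
  ip : M → M → B
  ip_add_smul_right : ∀ (ω η ζ : M) (x y : ℂ), ip ω (x • η + y • ζ) = x • ip ω η + y • ip ω ζ
  ip_op_smul_right : ∀ (ω η : M) (b : B), ip ω (MulOpposite.op b • η) = ip ω η * b
  star_ip : ∀ ω η : M, star (ip η ω) = ip ω η
  ip_self_nonneg : ∀ ω : M, 0 ≤ ip ω ω
  ip_self_eq_zero : ∀ ω : M, ip ω ω = 0 ↔ ω = 0
  norm_eq : ∀ ω : M, ‖ω‖ = √‖ip ω ω‖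
  lact : A →ₐ[ℂ] (M →L[ℂ] M)
  lact_op_smul : ∀ (a : A) (b : B) (ω : M),
    lact a (MulOpposite.op b • ω) = MulOpposite.op b • lact a ω
  ip_lact : ∀ (a : A) (ω η : M), ip (lact a ω) η = ip ω (lact (star a) η)
  L : A → ℝ≥0∞
  S : B → ℝ≥0∞
  DN : M → ℝ≥0∞

attribute [instance] CorrData.cstarA CorrData.cstarB CorrData.orderB CorrData.starOrderB
  CorrData.normM CorrData.spaceM CorrData.rightM CorrData.completeM

/-- `P` is an `(F, K, G, H)`-metrical C*-correspondence. -/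
structure CorrData.IsMetrical (F K G H : ℝ≥0) (P : CorrData) : Prop where
  qcms_left : IsQCMS F K P.L
  qcms_right : IsQCMS F K P.S
  DN_add_le : ∀ ω η, P.DN (ω + η) ≤ P.DN ω + P.DN η
  DN_smul : ∀ (z : ℂ) (ω : P.M), P.DN (z • ω) = ‖z‖ₑ * P.DN ω
  dense_dom : Dense {ω | P.DN ω < ∞}
  norm_le_DN : ∀ ω, ‖ω‖ₑ ≤ P.DN ω
  isCompact_ball : IsCompact {ω | P.DN ω ≤ 1}
  modular_leibniz : ∀ a ω, P.L a < ∞ → P.DN ω < ∞ →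
    P.DN (P.lact a ω) ≤ G * (‖a‖ₑ + P.L a) * P.DN ω
  inner_leibniz : ∀ ω η, P.DN ω < ∞ → P.DN η < ∞ →
    max (P.S (ℜ (P.ip ω η) : P.B)) (P.S (ℑ (P.ip ω η) : P.B)) ≤ H * P.DN ω * P.DN η

/-- Lipschitz morphisms between metrical C*-correspondences. -/
structure LipschitzMorphism (P Q : CorrData) where
  onM : P.M →L[ℂ] Q.M
  onA : P.A →⋆ₐ[ℂ] Q.A
  onB : P.B →⋆ₐ[ℂ] Q.B
  map_lact : ∀ a ω, onM (P.lact a ω) = Q.lact (onA a) (onM ω)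
  map_op_smul : ∀ (b : P.B) (ω : P.M),
    onM (MulOpposite.op b • ω) = MulOpposite.op (onB b) • onM ω
  map_ip : ∀ ω η, onB (P.ip ω η) = Q.ip (onM ω) (onM η)
  map_dom_L : ∀ a, P.L a < ∞ → Q.L (onA a) < ∞
  map_dom_S : ∀ b, P.S b < ∞ → Q.S (onB b) < ∞
  map_dom_DN : ∀ ω, P.DN ω < ∞ → Q.DN (onM ω) < ∞

/-- Modular quantum isometries. -/
structure ModularQuantumIsometry (P Q : CorrData) extends LipschitzMorphism P Q where
  L_eq : ∀ a, Q.L a < ∞ → Q.L a = sInf {l | ∃ d, P.L d < ∞ ∧ onA d = a ∧ P.L d = l}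
  S_eq : ∀ b, Q.S b < ∞ → Q.S b = sInf {l | ∃ d, P.S d < ∞ ∧ onB d = b ∧ P.S d = l}
  DN_eq : ∀ ω, Q.DN ω < ∞ → Q.DN ω = sInf {l | ∃ η, P.DN η < ∞ ∧ onM η = ω ∧ P.DN η = l}

/-- Metrical tunnels: the intermediate object `P` is an arbitrary `(F, K, G, H)`-metrical
C*-correspondence. -/
structure Tunnel.{s, a₁, b₁, m₁, a₂, b₂, m₂} (F K G H : ℝ≥0) (M₁ : CorrData.{a₁, b₁, m₁})
    (M₂ : CorrData.{a₂, b₂, m₂}) where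
  P : CorrData.{s, s, s}
  isMetrical : P.IsMetrical F K G H
  proj₁ : ModularQuantumIsometry P M₁
  proj₂ : ModularQuantumIsometry P M₂

namespace Tunnel

variable {F K G H : ℝ≥0} {M₁ M₂ : CorrData}

/-- The reversed tunnel. -/
def symm (τ : Tunnel F K G H M₁ M₂) : Tunnel F K G H M₂ M₁ :=
  ⟨τ.P, τ.isMetrical, τ.proj₂, τ.proj₁⟩

/-- The states of `D` of the form `φ ∘ π`, with `φ` a state of the codomain of `π`. -/
def pulledStates {D A : Type*} [CStarAlgebra D] [CStarAlgebra A] (π : D →⋆ₐ[ℂ] A) :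
    Set (WeakDual ℂ D) :=
  {χ | ∃ φ ∈ stateSpace A, ∀ d, χ d = φ (π d)}

/-- The part of the extent that concerns one of the two quantum isometries. -/
def extentAlong {P Q : CorrData} (f : ModularQuantumIsometry P Q) : ℝ≥0∞ :=
  max
    (haus (fun φ ψ : WeakDual ℂ P.A => mkDist P.L φ ψ) (pulledStates f.onA) (stateSpace P.A))
    (haus (fun φ ψ : WeakDual ℂ P.B => mkDist P.S φ ψ) (pulledStates f.onB) (stateSpace P.B))

/-- The extent of a tunnel. -/
def extent (τ : Tunnel F K G H M₁ M₂) : ℝ≥0∞ :=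
  max (extentAlong τ.proj₁) (extentAlong τ.proj₂)

end Tunnel

/-! ### Unbounded operators -/

section Unbounded

variable {E : Type*} [NormedAddCommGroup E] [InnerProductSpace ℂ E]

/-- `R` is the bounded inverse of `D - z : dom D → E`. -/
def IsResolventAt (D : E →ₗ.[ℂ] E) (z : ℂ) (R : E →L[ℂ] E) : Prop :=
  (∀ y : E, ∃ x : D.domain, (x : E) = R y ∧ D x - z • (x : E) = y) ∧
    ∀ x : D.domain, R (D x - z • (x : E)) = x

/-- The spectrum of an unbounded operator. -/
def opSpectrum (D : E →ₗ.[ℂ] E) : Set ℂ :=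
  {z | ¬ ∃ R : E →L[ℂ] E, IsResolventAt D z R}

/-- The eigenspace `{x ∈ dom D | D x = μ x}`. -/
def opEigenspace (D : E →ₗ.[ℂ] E) (μ : ℂ) : Submodule ℂ E :=
  (LinearMap.ker (D.toFun - μ • D.domain.subtype)).map D.domain.subtype

theorem mem_opEigenspace {D : E →ₗ.[ℂ] E} {μ : ℂ} {x : E} :
    x ∈ opEigenspace D μ ↔ ∃ y : D.domain, (y : E) = x ∧ D y = μ • x := by
  constructor
  · rintro ⟨y, hy, rfl⟩
    exact ⟨y, rfl, sub_eq_zero.mp hy⟩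
  · rintro ⟨y, rfl, hy⟩
    exact ⟨y, sub_eq_zero.mpr hy, rfl⟩

/-- The multiplicity of `μ` for `D`: the dimension of the eigenspace. -/
def multiplicity (μ : ℂ) (D : E →ₗ.[ℂ] E) : ℕ :=
  Module.finrank ℂ (opEigenspace D μ)

/-- An operator with a compact resolvent has finite-dimensional eigenspaces. -/
theorem finiteDimensional_opEigenspace [CompleteSpace E] {D : E →ₗ.[ℂ] E} {z : ℂ}
    {R : E →L[ℂ] E} (hR : IsResolventAt D z R) (hc : IsCompactOperator R) (μ : ℂ) :
    FiniteDimensional ℂ (opEigenspace D μ) := by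
  have key : ∀ x ∈ opEigenspace D μ, (μ - z) • R x = x := by
    intro x hx
    obtain ⟨y, rfl, hy⟩ := mem_opEigenspace.mp hx
    have := hR.2 y
    rwa [hy, ← sub_smul, map_smul] at this
  by_cases h : μ - z = 0
  · have : opEigenspace D μ = ⊥ := by
      rw [Submodule.eq_bot_iff]
      intro x hx
      rw [← key x hx, h, zero_smul]
    rw [this]
    infer_instance
  · have hfd := ContinuousLinearMap.finite_dimensional_eigenspace hc (μ - z)⁻¹ (inv_ne_zero h)
    refine Submodule.finiteDimensional_of_le (S₂ := Module.End.eigenspace R.toLinearMap (μ - z)⁻¹) ?_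
    intro x hx
    rw [Module.End.mem_eigenspace_iff]
    calc R x = (μ - z)⁻¹ • ((μ - z) • R x) := by rw [smul_smul, inv_mul_cancel₀ h, one_smul]
      _ = (μ - z)⁻¹ • x := by rw [key x hx]

end Unbounded

/-! ### Spectral triples -/

/-- The domain and the values of `a ↦ ‖[D, a]‖`, for an operator `a`: the least `C` such that `a`
maps `dom D` to itself and `[D, a]` is bounded by `C` on `dom D`, and `∞` if there is none. -/
def commNorm {E : Type*} [NormedAddCommGroup E] [NormedSpace ℂ E] (D : E →ₗ.[ℂ] E)
    (a : E →L[ℂ] E) : ℝ≥0∞ :=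
  ⨅ C : {C : ℝ≥0 // ∀ x : D.domain, ∃ y : D.domain,
    (y : E) = a x ∧ ‖D y - a (D x)‖ ≤ C * ‖(x : E)‖}, ((C : ℝ≥0) : ℝ≥0∞)

open Classical in
/-- The seminorm `a ↦ ‖[D, a]‖` on the self-adjoint elements of `A`, represented by `rep`. -/
def lipOf {A E : Type*} [CStarAlgebra A] [NormedAddCommGroup E] [InnerProductSpace ℂ E]
    [CompleteSpace E] (rep : A →⋆ₐ[ℂ] (E →L[ℂ] E)) (D : E →ₗ.[ℂ] E) (a : A) : ℝ≥0∞ :=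
  if IsSelfAdjoint a then commNorm D (rep a) else ∞

/-- Spectral triples: `D` is self-adjoint, `D + i` has a compact inverse, and the self-adjoint
elements with a bounded commutator with `D` are dense in the self-adjoint part of `A`. -/
structure SpectralTriple.{a, h} where
  A : Type a
  H : Type h
  [cstarA : CStarAlgebra A]
  [normH : NormedAddCommGroup H]
  [innerH : InnerProductSpace ℂ H]
  [completeH : CompleteSpace H]
  rep : A →⋆ₐ[ℂ] (H →L[ℂ] H)
  D : H →ₗ.[ℂ] H
  dense_dom : Dense (D.domain : Set H)
  isSelfAdjoint : IsSelfAdjoint D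
  compact_resolvent : ∃ R : H →L[ℂ] H, IsResolventAt D (-Complex.I) R ∧ IsCompactOperator R
  dense_lip : ∀ a : A, IsSelfAdjoint a → a ∈ closure {b | lipOf rep D b < ∞}

attribute [instance] SpectralTriple.cstarA SpectralTriple.normH SpectralTriple.innerH
  SpectralTriple.completeH

namespace SpectralTriple

variable (T : SpectralTriple)

/-- The Lipschitz seminorm `‖[D, a]‖`. -/
def lip (a : T.A) : ℝ≥0∞ := lipOf T.rep T.D a

/-- A spectral triple is metric when `(A, ‖[D, ·]‖)` is a quantum compact metric space; the Leibniz
inequality with `F = 1` and `K = 0` always holds. -/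
def IsMetric : Prop := IsQCMS 1 0 T.lip

open Classical in
/-- The graph norm `‖x‖ + ‖D x‖`, with value `∞` outside the domain of `D`. -/
def graphNorm (x : T.H) : ℝ≥0∞ :=
  if h : x ∈ T.D.domain then ‖x‖ₑ + ‖T.D ⟨x, h⟩‖ₑ else ∞

instance (μ : ℂ) : FiniteDimensional ℂ (opEigenspace T.D μ) := by
  obtain ⟨R, hR, hc⟩ := T.compact_resolvent
  exact finiteDimensional_opEigenspace hR hc μ

/-- The unitary `exp (i t D)`. As `D` is self-adjoint with compact resolvent, `H` is the Hilbert sum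
of the eigenspaces of `D`, with real eigenvalues, and `exp (i t D) x` is the sum over `μ` of
`exp (i t μ) P_μ x`, where `P_μ` is the orthogonal projection onto the eigenspace for `μ`. -/
def expI (t : ℝ) (x : T.H) : T.H :=
  ∑' μ : ℝ, Complex.exp (Complex.I * t * μ) • (opEigenspace T.D μ).starProjection x

/-- A Hilbert space as a right module over `ℂ`. -/
@[reducible]
def rightModule (E : Type*) [NormedAddCommGroup E] [NormedSpace ℂ E] : Module ℂᵐᵒᵖ E :=
  Module.compHom E (RingEquiv.toOpposite ℂ).symm.toRingHom

open Classical in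
/-- The metrical C*-correspondence `(H, ‖x‖ + ‖D x‖, A, ‖[D, a]‖, ℂ, 0)` of a spectral triple. -/
abbrev mcc : CorrData :=
  letI := rightModule T.H
  { A := T.A
    B := ℂ
    M := T.H
    ip := fun x y => inner ℂ x y
    ip_add_smul_right := fun ω η ζ x y => by
      rw [inner_add_right, inner_smul_right, inner_smul_right, smul_eq_mul, smul_eq_mul]
    ip_op_smul_right := fun ω η b => by
      change inner ℂ ω (b • η) = inner ℂ ω η * b
      rw [inner_smul_right, mul_comm]
    star_ip := fun ω η => inner_conj_symm ω η
    ip_self_nonneg := fun ω => by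
      rw [← inner_self_ofReal_re, RCLike.ofReal_nonneg]
      exact inner_self_nonneg
    ip_self_eq_zero := fun ω => inner_self_eq_zero
    norm_eq := fun ω => by
      rw [inner_self_eq_norm_sq_to_K]
      simp
    lact := T.rep.toAlgHom
    lact_op_smul := fun a b ω => map_smul (T.rep a) b ω
    ip_lact := fun a ω η => by
      change inner ℂ (T.rep a ω) η = inner ℂ ω (T.rep (star a) η)
      rw [map_star, ContinuousLinearMap.star_eq_adjoint, ContinuousLinearMap.adjoint_inner_right]
    L := T.lip
    S := fun b => if IsSelfAdjoint b then 0 else ∞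
    DN := T.graphNorm }

end SpectralTriple

/-! ### The spectral propinquity -/

/-- `ε`-iso-isos of the monoid `[0, ∞)`. -/
def IsIsoIso (ε : ℝ) (ς₁ ς₂ : ℝ≥0 → ℝ≥0) : Prop :=
  ς₁ 0 = 0 ∧ ς₂ 0 = 0 ∧ ∀ x y z : ℝ≥0, (x : ℝ) ≤ 1 / ε → (y : ℝ) ≤ 1 / ε → (z : ℝ) ≤ 1 / ε →
    |(|(ς₁ x : ℝ) + ς₁ y - z| - |(x : ℝ) + y - ς₂ z|)| < ε ∧
    |(|(ς₂ x : ℝ) + ς₂ y - z| - |(x : ℝ) + y - ς₁ z|)| < ε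

section Propinquity

variable {F K G H : ℝ≥0} {T₁ T₂ : SpectralTriple}

/-- The family `(⟨U^(-ς(t)) ξ, Π(·)⟩)`, for `t` in `[0, 1/ε]`, with `U^t = exp (i t D)`. -/
def orbit {P : CorrData} (T : SpectralTriple) (f : ModularQuantumIsometry P T.mcc) (ε : ℝ)
    (ς : ℝ≥0 → ℝ≥0) (ξ : T.H) : {t : ℝ≥0 // (t : ℝ) ≤ 1 / ε} → P.M → ℂ :=
  fun t ω => inner ℂ (T.expI (-(ς t : ℝ)) ξ) (f.onM ω : T.H)

/-- The set of the families `orbit` over the unit ball of the graph norm. -/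
def orbits {P : CorrData} (T : SpectralTriple) (f : ModularQuantumIsometry P T.mcc) (ε : ℝ)
    (ς : ℝ≥0 → ℝ≥0) : Set ({t : ℝ≥0 // (t : ℝ) ≤ 1 / ε} → P.M → ℂ) :=
  {g | ∃ ξ : T.H, T.graphNorm ξ ≤ 1 ∧ g = orbit T f ε ς ξ}

/-- One half of the `ε`-reach. -/
def halfReach (τ : Tunnel F K G H T₁.mcc T₂.mcc) (ε : ℝ) (ς : ℝ≥0 → ℝ≥0) : ℝ≥0∞ :=
  oneSidedHaus (mkFamilyDist τ.P.DN) (orbits T₁ τ.proj₁ ε id) (orbits T₂ τ.proj₂ ε ς)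

/-- The `ε`-reach of a tunnel with two maps. -/
def reach (τ : Tunnel F K G H T₁.mcc T₂.mcc) (ε : ℝ) (ς₁ ς₂ : ℝ≥0 → ℝ≥0) : ℝ≥0∞ :=
  max (halfReach τ ε ς₁) (halfReach τ.symm ε ς₂)

/-- The `ε`-magnitude. -/
def magnitude (τ : Tunnel F K G H T₁.mcc T₂.mcc) (ε : ℝ) (ς₁ ς₂ : ℝ≥0 → ℝ≥0) : ℝ≥0∞ :=
  max τ.extent (reach τ ε ς₁ ς₂)

end Propinquity

/-- The spectral propinquity, for the constants `F, K, G, H`. The intermediate objects of the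
tunnels are taken in the universe `s`, without loss: a metrical C*-correspondence is separable, as
the unit balls of its three gauges are compact modulo scalars. -/
def spectralPropinquity.{s, u₁, v₁, u₂, v₂} (F K G H : ℝ≥0) (T₁ : SpectralTriple.{u₁, v₁})
    (T₂ : SpectralTriple.{u₂, v₂}) : ℝ :=
  sInf (insert (√2 / 2) {ε : ℝ | 0 < ε ∧
    ∃ (τ : Tunnel.{s, u₁, 0, v₁, u₂, 0, v₂} F K G H T₁.mcc T₂.mcc) (ς₁ ς₂ : ℝ≥0 → ℝ≥0),
      IsIsoIso ε ς₁ ς₂ ∧ magnitude τ ε ς₁ ς₂ < ENNReal.ofReal ε})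

end SpectralPropinquity

end

/-! A tunnel of small magnitude almost intertwines the unitary groups of the two operators, so
eigenvectors of one operator turn into vectors of the other with spectral mass near the same
eigenvalue, and they do so linearly.

Let `lam` be an eigenvalue of `T₂.D`. Its eigenspace lifts linearly to the tunnel
(`exists_linear_lift`) and the lift is sent to `T₁.H`. Since `ℂ` has only one state, the extent
makes the two characters of the right algebra of the tunnel close; with the inner Leibniz
inequality, inner products of lifted vectors are the same on both sides up to `2Hε`
(`norm_inner_toHilbert_sub_le`). The reach then gives that the image `x` of a suitably scaled
eigenvector satisfies `⟨exp(-itD₁)x, x⟩ ≈ exp(it lam)‖x‖²` for `0 ≤ t ≤ 1/ε`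
(`norm_inner_expI_sub_exp_le`). Integrating over a time `2/r` forces `x` to have a nonzero component
in an eigenspace for some `μ` with `|μ - lam| < r` (`exists_starProjection_ne_zero`). If only one
such `μ` exists, projecting onto its eigenspace is injective on the transported eigenspace, whence
an inequality of multiplicities (`IsHalfClose.multiplicity_le`).

The theorem applies this to a tunnel and to its reverse. Near `lam`, the only eigenvalue of `D_n` is
`λ_n` by hypothesis; near `λ_n`, the only eigenvalue of `D_∞` is `lam` because a compact resolvent
isolates eigenvalues. How small `ε` must be depends on the dimension of the lifted eigenspace;
eventual constancy makes this uniform in `n` in the reverse direction. -/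

noncomputable section

namespace SpectralPropinquity

/-! ### Hilbert sums of subspaces -/

section HilbertSum

variable {ι E : Type*} [NormedAddCommGroup E] [InnerProductSpace ℂ E]
  {V : ι → Submodule ℂ E} [∀ i, FiniteDimensional ℂ (V i)]

theorem starProjection_eq_zero_of_mem_of_ne
    (hV : OrthogonalFamily ℂ (fun i => V i) fun i => (V i).subtypeₗᵢ) {i j : ι} (hij : i ≠ j)
    {x : E} (hx : x ∈ V i) : (V j).starProjection x = 0 := by
  rw [Submodule.starProjection_apply_eq_zero_iff, Submodule.mem_orthogonal]
  exact fun u hu => hV hij.symm ⟨u, hu⟩ ⟨x, hx⟩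

theorem inner_starProjection_self (W : Submodule ℂ E) [W.HasOrthogonalProjection] (x : E) :
    inner ℂ x (W.starProjection x) = ((‖W.starProjection x‖ ^ 2 : ℝ) : ℂ) := by
  have h : W.starProjection (W.starProjection x) = W.starProjection x :=
    Submodule.starProjection_eq_self_iff.mpr (Submodule.starProjection_apply_mem _ _)
  rw [← h, ← Submodule.inner_starProjection_left_eq_right, h, inner_self_eq_norm_sq_to_K]
  simp

variable [CompleteSpace E]

theorem hasSum_starProjection (hV : IsHilbertSum ℂ (fun i => V i) fun i => (V i).subtypeₗᵢ)
    (x : E) : HasSum (fun i => (V i).starProjection x) x := by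
  have h := hV.hasSum_linearIsometryEquiv_symm (hV.linearIsometryEquiv x)
  rw [LinearIsometryEquiv.symm_apply_apply] at h
  convert h using 2 with i
  have h1 := (V i).starProjection.hasSum h
  have h2 : HasSum (fun j => (V i).starProjection
      ((V j).subtypeₗᵢ (hV.linearIsometryEquiv x j))) ((V i).subtypeₗᵢ
        (hV.linearIsometryEquiv x i)) := by
    have h3 := hasSum_single (f := fun j => (V i).starProjection
      ((V j).subtypeₗᵢ (hV.linearIsometryEquiv x j))) i (fun j hj =>
        starProjection_eq_zero_of_mem_of_ne hV.OrthogonalFamily hj (Subtype.property _))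
    convert h3 using 1
    exact (Submodule.starProjection_eq_self_iff.mpr (Subtype.property _)).symm
  exact h1.unique h2

theorem hasSum_norm_sq_starProjection
    (hV : IsHilbertSum ℂ (fun i => V i) fun i => (V i).subtypeₗᵢ) (x : E) :
    HasSum (fun i => ‖(V i).starProjection x‖ ^ 2) (‖x‖ ^ 2) := by
  have h := (innerSL ℂ x).hasSum (hasSum_starProjection hV x)
  simp only [innerSL_apply_apply, inner_starProjection_self, inner_self_eq_norm_sq_to_K] at h
  rw [← Complex.hasSum_ofReal]
  simpa using h

theorem summable_smul_starProjection
    (hV : IsHilbertSum ℂ (fun i => V i) fun i => (V i).subtypeₗᵢ) {c : ι → ℂ}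
    (hc : ∀ i, ‖c i‖ = 1) (x : E) : Summable fun i => c i • (V i).starProjection x := by
  have := (hV.OrthogonalFamily.summable_iff_norm_sq_summable
    (fun i => c i • (V i).orthogonalProjectionOnto x)).mpr (by
      refine (hasSum_norm_sq_starProjection hV x).summable.congr fun i => ?_
      rw [norm_smul, hc, one_mul]
      rfl)
  simpa using this

theorem starProjection_tsum_smul
    (hV : IsHilbertSum ℂ (fun i => V i) fun i => (V i).subtypeₗᵢ) {c : ι → ℂ}
    (hc : ∀ i, ‖c i‖ = 1) (x : E) (j : ι) :
    (V j).starProjection (∑' i, c i • (V i).starProjection x) =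
      c j • (V j).starProjection x := by
  have h1 := (V j).starProjection.hasSum (summable_smul_starProjection hV hc x).hasSum
  have h2 := hasSum_single (f := fun i => (V j).starProjection (c i • (V i).starProjection x)) j
    (fun i hi => starProjection_eq_zero_of_mem_of_ne hV.OrthogonalFamily hi
      ((V i).smul_mem _ (Submodule.starProjection_apply_mem _ _)))
  rw [h1.unique h2]
  exact Submodule.starProjection_eq_self_iff.mpr
    ((V j).smul_mem _ (Submodule.starProjection_apply_mem _ _))

theorem norm_tsum_smul_starProjection
    (hV : IsHilbertSum ℂ (fun i => V i) fun i => (V i).subtypeₗᵢ) {c : ι → ℂ}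
    (hc : ∀ i, ‖c i‖ = 1) (x : E) : ‖∑' i, c i • (V i).starProjection x‖ = ‖x‖ := by
  have h1 := hasSum_norm_sq_starProjection hV (∑' i, c i • (V i).starProjection x)
  simp only [starProjection_tsum_smul hV hc, norm_smul, hc, one_mul] at h1
  exact (sq_eq_sq₀ (norm_nonneg _) (norm_nonneg _)).mp
    (h1.unique (hasSum_norm_sq_starProjection hV x))

end HilbertSum

/-! ### Self-adjoint operators with a compact resolvent -/

section SelfAdjoint

variable {E : Type*} [NormedAddCommGroup E] [InnerProductSpace ℂ E]
  {D : E →ₗ.[ℂ] E} {R : E →L[ℂ] E}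

theorem IsResolventAt.eq_of_apply_sub {z : ℂ} (hR : IsResolventAt D z R) {x y : E}
    (h : ∃ u : D.domain, (u : E) = x ∧ D u - z • (u : E) = y) : R y = x := by
  obtain ⟨u, rfl, rfl⟩ := h
  exact hR.2 u

theorem IsResolventAt.injective {z : ℂ} (hR : IsResolventAt D z R) {y : E} (h : R y = 0) :
    y = 0 := by
  obtain ⟨u, hu, hDu⟩ := hR.1 y
  have : u = 0 := Subtype.ext (hu.trans h)
  rw [← hDu, this]
  simp

theorem opEigenspace_le_eigenspace_resolvent {z μ : ℂ} (hR : IsResolventAt D z R) (hz : μ ≠ z) :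
    opEigenspace D μ ≤ Module.End.eigenspace R.toLinearMap (μ - z)⁻¹ := by
  intro x hx
  obtain ⟨y, rfl, hy⟩ := mem_opEigenspace.mp hx
  have h := hR.2 y
  rw [hy, ← sub_smul, map_smul] at h
  rw [Module.End.mem_eigenspace_iff, eq_inv_smul_iff₀ (sub_ne_zero.mpr hz)]
  exact h

theorem eigenspace_resolvent_le_opEigenspace {z ρ : ℂ} (hR : IsResolventAt D z R) (hρ : ρ ≠ 0) :
    Module.End.eigenspace R.toLinearMap ρ ≤ opEigenspace D (ρ⁻¹ + z) := by
  intro x hx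
  rw [Module.End.mem_eigenspace_iff] at hx
  obtain ⟨y, hy, hDy⟩ := hR.1 (ρ⁻¹ • x)
  have hx' : R x = ρ • x := hx
  rw [map_smul, hx', smul_smul, inv_mul_cancel₀ hρ, one_smul] at hy
  refine mem_opEigenspace.mpr ⟨y, hy, ?_⟩
  rw [sub_eq_iff_eq_add] at hDy
  rw [hDy, hy, add_smul]

theorem ofReal_ne_neg_I (μ : ℝ) : (μ : ℂ) ≠ -Complex.I := by
  intro h
  simpa using congrArg Complex.im h

variable [CompleteSpace E]

theorem inner_apply_left_of_isSelfAdjoint (hs : IsSelfAdjoint D) (x y : D.domain) :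
    inner ℂ (D x) (y : E) = inner ℂ (x : E) (D y) := by
  have h := LinearPMap.adjoint_isFormalAdjoint hs.dense_domain
  rw [LinearPMap.isSelfAdjoint_def.mp hs] at h
  exact h x y

theorem exists_apply_eq_of_isSelfAdjoint (hs : IsSelfAdjoint D) {y z : E}
    (h : ∀ x : D.domain, inner ℂ z (x : E) = inner ℂ y (D x)) :
    ∃ x : D.domain, (x : E) = y ∧ D x = z := by
  have h1 : y ∈ D.adjoint.domain := LinearPMap.mem_adjoint_domain_of_exists y ⟨z, h⟩
  have h2 := LinearPMap.adjoint_apply_eq hs.dense_domain ⟨y, h1⟩ h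
  have h3 := LinearPMap.isSelfAdjoint_def.mp hs
  generalize D.adjoint = D' at h1 h2 h3
  subst h3
  exact ⟨⟨y, h1⟩, rfl, h2⟩

theorem IsResolventAt.adjoint (hs : IsSelfAdjoint D) (hR : IsResolventAt D (-Complex.I) R) :
    IsResolventAt D Complex.I (ContinuousLinearMap.adjoint R) := by
  constructor
  · intro y
    obtain ⟨x, hx, hDx⟩ := exists_apply_eq_of_isSelfAdjoint hs
      (y := ContinuousLinearMap.adjoint R y)
      (z := y + Complex.I • ContinuousLinearMap.adjoint R y) (by
        intro u
        have h := hR.2 u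
        have h1 : inner ℂ (ContinuousLinearMap.adjoint R y) (D u - -Complex.I • (u : E)) =
            inner ℂ y (u : E) := by
          rw [ContinuousLinearMap.adjoint_inner_left, h]
        rw [inner_sub_right, inner_smul_right] at h1
        rw [inner_add_left, inner_smul_left, Complex.conj_I, ← h1]
        ring)
    exact ⟨x, hx, by rw [hDx, hx, add_sub_cancel_right]⟩
  · intro x
    refine ext_inner_right ℂ fun a => ?_
    obtain ⟨u, hu, hDu⟩ := hR.1 a
    rw [ContinuousLinearMap.adjoint_inner_left, ← hu, inner_sub_left, inner_smul_left,
      Complex.conj_I, inner_apply_left_of_isSelfAdjoint hs, ← inner_smul_right, ← inner_sub_right,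
      hDu]

theorem orthogonalFamily_opEigenspace (hs : IsSelfAdjoint D) :
    OrthogonalFamily ℂ (fun μ : ℝ => opEigenspace D μ)
      fun μ => (opEigenspace D (μ : ℂ)).subtypeₗᵢ := by
  rintro μ ν hμν ⟨x, hx⟩ ⟨y, hy⟩
  obtain ⟨x, rfl, hx⟩ := mem_opEigenspace.mp hx
  obtain ⟨y, rfl, hy⟩ := mem_opEigenspace.mp hy
  have h := inner_apply_left_of_isSelfAdjoint hs x y
  rw [hx, hy, inner_smul_left, inner_smul_right, Complex.conj_ofReal, ← sub_eq_zero,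
    ← sub_mul] at h
  refine (mul_eq_zero.mp h).resolve_left (sub_ne_zero.mpr ?_)
  exact_mod_cast hμν

theorem opEigenspace_eq_bot_of_im_ne_zero (hs : IsSelfAdjoint D) {μ : ℂ} (hμ : μ.im ≠ 0) :
    opEigenspace D μ = ⊥ := by
  rw [Submodule.eq_bot_iff]
  intro x hx
  obtain ⟨y, rfl, hy⟩ := mem_opEigenspace.mp hx
  have h := inner_apply_left_of_isSelfAdjoint hs y y
  rw [hy, inner_smul_left, inner_smul_right, ← sub_eq_zero, ← sub_mul] at h
  refine inner_self_eq_zero.mp ((mul_eq_zero.mp h).resolve_left fun h' => hμ ?_)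
  exact Complex.conj_eq_iff_im.mp (sub_eq_zero.mp h')

/-- Both products come out of the resolvent identity between `-i` and `i`: `R - R* = -2i R*R = -2i
RR*`. -/
theorem IsResolventAt.commute_adjoint (hs : IsSelfAdjoint D)
    (hR : IsResolventAt D (-Complex.I) R) (x : E) :
    R (ContinuousLinearMap.adjoint R x) = ContinuousLinearMap.adjoint R (R x) := by
  have hR' := hR.adjoint hs
  have h1 : R x = ContinuousLinearMap.adjoint R (x - (2 * Complex.I) • R x) := by
    obtain ⟨u, hu, hDu⟩ := hR.1 x
    refine (hR'.eq_of_apply_sub ⟨u, hu, ?_⟩).symm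
    rw [← hu, ← hDu]
    module
  have h2 : ContinuousLinearMap.adjoint R x =
      R (x + (2 * Complex.I) • ContinuousLinearMap.adjoint R x) := by
    obtain ⟨u, hu, hDu⟩ := hR'.1 x
    refine (hR.eq_of_apply_sub ⟨u, hu, ?_⟩).symm
    rw [← hu, ← hDu]
    module
  rw [map_sub, map_smul] at h1
  rw [map_add, map_smul] at h2
  have h3 : (2 * Complex.I) • R (ContinuousLinearMap.adjoint R x) =
      (2 * Complex.I) • ContinuousLinearMap.adjoint R (R x) := by
    rw [eq_sub_iff_add_eq] at h1
    rw [← sub_eq_iff_eq_add'] at h2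
    rw [← h2, ← h1, add_sub_cancel_left]
  exact smul_right_injective E (show 2 * Complex.I ≠ 0 by simp) h3

end SelfAdjoint

/-! ### Spectral theorem for a compact resolvent -/

section CompactResolvent

variable {E : Type*} [NormedAddCommGroup E] [InnerProductSpace ℂ E]
  {D : E →ₗ.[ℂ] E} {R : E →L[ℂ] E}

theorem mem_opSpectrum_of_opEigenspace_ne_bot {μ : ℂ} (h : opEigenspace D μ ≠ ⊥) :
    μ ∈ opSpectrum D := by
  rintro ⟨Q, hQ⟩
  obtain ⟨x, hx, hx0⟩ := Submodule.exists_mem_ne_zero_of_ne_bot h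
  obtain ⟨y, rfl, hy⟩ := mem_opEigenspace.mp hx
  have := hQ.2 y
  rw [hy, sub_self, map_zero] at this
  exact hx0 this.symm

variable [CompleteSpace E]

/-- `R` need not be self-adjoint, so the spectral theorem is applied to `R*R`. For `s ≠ 0` its
eigenspace is finite-dimensional, lies in `dom D` and is stable under `D`, which is symmetric there
and can be diagonalized. -/
theorem eigenspace_adjoint_comp_self_le (hs : IsSelfAdjoint D)
    (hR : IsResolventAt D (-Complex.I) R) (hc : IsCompactOperator R) (s : ℂ) :
    Module.End.eigenspace (ContinuousLinearMap.adjoint R ∘L R).toLinearMap s ≤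
      ⨆ μ : ℝ, opEigenspace D μ := by
  set S : E →L[ℂ] E := ContinuousLinearMap.adjoint R ∘L R with hS
  have hmem (x : E) : x ∈ Module.End.eigenspace S.toLinearMap s ↔
      ContinuousLinearMap.adjoint R (R x) = s • x := Module.End.mem_eigenspace_iff
  have hR' := hR.adjoint hs
  rcases eq_or_ne s 0 with rfl | hs0
  · intro x hx
    rw [hmem, zero_smul] at hx
    rw [hR.injective (hR'.injective hx)]
    exact Submodule.zero_mem _
  have hSc : IsCompactOperator S := hc.clm_comp (ContinuousLinearMap.adjoint R)
  have hfd : FiniteDimensional ℂ (Module.End.eigenspace S.toLinearMap s) :=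
    ContinuousLinearMap.finite_dimensional_eigenspace hSc s hs0
  -- On this eigenspace `x = R*(s⁻¹ R x)` and `R* = (D - i)⁻¹`, which makes `D` an explicit
  -- endomorphism.
  have hdom (x : E) (hx : x ∈ Module.End.eigenspace S.toLinearMap s) :
      ∃ u : D.domain, (u : E) = x ∧ D u = s⁻¹ • R x + Complex.I • x := by
    obtain ⟨u, hu, hDu⟩ := hR'.1 (s⁻¹ • R x)
    rw [map_smul, (hmem x).mp hx, smul_smul, inv_mul_cancel₀ hs0, one_smul] at hu
    exact ⟨u, hu, by rw [← hDu, hu]; abel⟩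
  have hinv : ∀ x ∈ Module.End.eigenspace S.toLinearMap s,
      (s⁻¹ • R.toLinearMap + Complex.I • LinearMap.id : E →ₗ[ℂ] E) x ∈
        Module.End.eigenspace S.toLinearMap s := by
    intro x hx
    refine Submodule.add_mem _ (Submodule.smul_mem _ _ ?_) (Submodule.smul_mem _ _ hx)
    rw [hmem] at hx ⊢
    rw [← hR.commute_adjoint hs]
    change R (ContinuousLinearMap.adjoint R (R x)) = s • R x
    rw [hx, map_smul]
  set T := (s⁻¹ • R.toLinearMap + Complex.I • LinearMap.id : E →ₗ[ℂ] E).restrict hinv with hT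
  have hTx (x) : (T x : E) = s⁻¹ • R x + Complex.I • (x : E) := rfl
  have hTs : T.IsSymmetric := by
    rintro ⟨x, hx⟩ ⟨y, hy⟩
    obtain ⟨u, hu, hDu⟩ := hdom x hx
    obtain ⟨w, hw, hDw⟩ := hdom y hy
    rw [Submodule.coe_inner, Submodule.coe_inner, hTx, hTx, ← hDu, ← hDw]
    change inner ℂ (D u) y = inner ℂ x (D w)
    rw [← hu, ← hw, inner_apply_left_of_isSelfAdjoint hs]
  have htop := Submodule.orthogonal_eq_bot_iff.mp hTs.orthogonalComplement_iSup_eigenspaces_eq_bot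
  have hle : (⨆ μ, Module.End.eigenspace T μ).map
      (Module.End.eigenspace S.toLinearMap s).subtype ≤ ⨆ μ : ℝ, opEigenspace D μ := by
    rw [Submodule.map_iSup]
    refine iSup_le fun μ => ?_
    have h1 : (Module.End.eigenspace T μ).map
        (Module.End.eigenspace S.toLinearMap s).subtype ≤ opEigenspace D μ := by
      rintro _ ⟨x, hx, rfl⟩
      obtain ⟨u, hu, hDu⟩ := hdom x x.2
      refine mem_opEigenspace.mpr ⟨u, hu, ?_⟩
      rw [hDu, ← hTx, Module.End.mem_eigenspace_iff.mp hx]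
      rfl
    refine h1.trans ?_
    by_cases hμ : μ.im = 0
    · have : μ = (μ.re : ℂ) := Complex.ext (by simp) (by simp [hμ])
      rw [this]
      exact le_iSup (fun ν : ℝ => opEigenspace D ν) μ.re
    · rw [opEigenspace_eq_bot_of_im_ne_zero hs hμ]
      exact bot_le
  rwa [htop, Submodule.map_subtype_top] at hle

theorem isHilbertSum_opEigenspace (hs : IsSelfAdjoint D)
    (hR : IsResolventAt D (-Complex.I) R) (hc : IsCompactOperator R) :
    IsHilbertSum ℂ (fun μ : ℝ => opEigenspace D μ)
      fun μ => (opEigenspace D (μ : ℂ)).subtypeₗᵢ := by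
  have hfd (μ : ℝ) : FiniteDimensional ℂ (opEigenspace D (μ : ℂ)) :=
    finiteDimensional_opEigenspace hR hc μ
  refine IsHilbertSum.mkInternal _ (orthogonalFamily_opEigenspace hs) ?_
  have h := ContinuousLinearMap.orthogonalComplement_iSup_eigenspaces_eq_bot
    (T := ContinuousLinearMap.adjoint R ∘L R) (hc.clm_comp (ContinuousLinearMap.adjoint R)) (by
      intro x y
      change inner ℂ (ContinuousLinearMap.adjoint R (R x)) y =
        inner ℂ x (ContinuousLinearMap.adjoint R (R y))
      rw [ContinuousLinearMap.adjoint_inner_left, ContinuousLinearMap.adjoint_inner_right])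
  rw [← Submodule.orthogonal_orthogonal_eq_closure, top_le_iff, Submodule.orthogonal_eq_top_iff,
    ← le_bot_iff, ← h]
  exact Submodule.orthogonal_le (iSup_le fun s => eigenspace_adjoint_comp_self_le hs hR hc s)

/-- Fredholm alternative for `R` at `ρ = (μ + i)⁻¹`: either `ρ` is an eigenvalue of `R`, which gives
an eigenvector of `D`, or `ρ - R` is invertible and `ρ R (ρ - R)⁻¹` inverts `D - μ`. -/
theorem opEigenspace_ne_bot_of_mem_opSpectrum (hR : IsResolventAt D (-Complex.I) R)
    (hc : IsCompactOperator R) {μ : ℝ} (hμ : (μ : ℂ) ∈ opSpectrum D) :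
    opEigenspace D (μ : ℂ) ≠ ⊥ := by
  intro hbot
  have hne : (μ : ℂ) - -Complex.I ≠ 0 := sub_ne_zero.mpr (ofReal_ne_neg_I μ)
  set ρ : ℂ := ((μ : ℂ) - -Complex.I)⁻¹ with hρ
  have hρ0 : ρ ≠ 0 := inv_ne_zero hne
  rcases hc.hasEigenvalue_or_mem_resolventSet hρ0 with h | h
  · refine h (eq_bot_iff.mpr ((eigenspace_resolvent_le_opEigenspace hR hρ0).trans ?_))
    rw [hρ, inv_inv, sub_add_cancel, hbot]
  · rw [spectrum.mem_resolventSet_iff] at h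
    obtain ⟨Q, hQ⟩ := h
    have hQ1 (x : E) : ρ • Q.inv x - R (Q.inv x) = x := by
      have := congrArg (fun f : E →L[ℂ] E => f x) Q.mul_inv
      rw [hQ] at this
      simpa [Algebra.algebraMap_eq_smul_one] using this
    have hQ2 (x : E) : Q.inv (ρ • x - R x) = x := by
      have := congrArg (fun f : E →L[ℂ] E => f x) Q.inv_mul
      rw [hQ] at this
      simpa [Algebra.algebraMap_eq_smul_one] using this
    refine hμ ⟨ρ • (R ∘L Q.inv), fun y => ?_, fun x => ?_⟩
    · obtain ⟨x, hx, hDx⟩ := hR.1 (Q.inv y)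
      refine ⟨ρ • x, by simp [hx], ?_⟩
      have h1 : D x = Q.inv y + -Complex.I • (x : E) := by rw [← hDx]; abel
      have h2 : ρ * ((μ : ℂ) - -Complex.I) = 1 := inv_mul_cancel₀ hne
      rw [LinearPMap.map_smul, Submodule.coe_smul, h1]
      calc ρ • (Q.inv y + -Complex.I • (x : E)) - (μ : ℂ) • ρ • (x : E)
          = ρ • Q.inv y - (ρ * ((μ : ℂ) - -Complex.I)) • (x : E) := by module
        _ = y := by rw [h2, one_smul, hx, hQ1]
    · have h2 : ρ * ((μ : ℂ) - -Complex.I) = 1 := inv_mul_cancel₀ hne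
      have h1 : R (D x) = (x : E) + -Complex.I • R (x : E) := by
        have := hR.2 x
        rw [map_sub, map_smul] at this
        rw [sub_eq_iff_eq_add] at this
        exact this
      have h3 : R (D x - (μ : ℂ) • (x : E)) =
          ((μ : ℂ) - -Complex.I) • (ρ • (x : E) - R x) := by
        rw [map_sub, map_smul, h1, smul_sub, smul_smul, mul_comm, h2]
        module
      have hcomm (y : E) : R (Q.inv y) = Q.inv (R y) := by
        have := hQ2 (R (Q.inv y))
        rw [← map_smul, ← map_sub, hQ1] at this
        exact this.symm
      change ρ • R (Q.inv _) = _
      rw [hcomm, h3, map_smul, hQ2, smul_smul, h2, one_smul]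

/-- The eigenvalues of a self-adjoint operator with compact resolvent are isolated. -/
theorem exists_isolating_opEigenspace (hs : IsSelfAdjoint D)
    (hR : IsResolventAt D (-Complex.I) R) (hc : IsCompactOperator R) (lam : ℝ) :
    ∃ r > 0, ∀ μ : ℝ, |μ - lam| < r → opEigenspace D (μ : ℂ) ≠ ⊥ → μ = lam := by
  have hR' := hR.adjoint hs
  set W := (opEigenspace D (lam : ℂ))ᗮ with hW
  -- The eigenspace of `D` for `lam` consists of eigenvectors of `R*`, so its orthogonal complement
  -- is stable under `R`.
  have hinv : ∀ x ∈ W, R x ∈ W := by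
    intro x hx
    rw [hW, Submodule.mem_orthogonal] at hx ⊢
    intro u hu
    have hI : (lam : ℂ) ≠ Complex.I := fun h => by simpa using congrArg Complex.im h
    have := Module.End.mem_eigenspace_iff.mp (opEigenspace_le_eigenspace_resolvent hR' hI hu)
    rw [← ContinuousLinearMap.adjoint_inner_left]
    change inner ℂ ((ContinuousLinearMap.adjoint R).toLinearMap u) x = 0
    rw [this, inner_smul_left, hx u hu, mul_zero]
  set ρ : ℝ → ℂ := fun μ => ((μ : ℂ) - -Complex.I)⁻¹ with hρ
  have hne (μ : ℝ) : (μ : ℂ) - -Complex.I ≠ 0 := sub_ne_zero.mpr (ofReal_ne_neg_I μ)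
  have hρ0 (μ : ℝ) : ρ μ ≠ 0 := inv_ne_zero (hne μ)
  have hone (μ : ℝ) : 1 ≤ ‖(μ : ℂ) - -Complex.I‖ := by
    simpa using Complex.abs_im_le_norm ((μ : ℂ) - -Complex.I)
  have hRW : IsCompactOperator (R.restrict hinv) := hc.restrict' hinv
  -- With the eigenspace removed, `ρ lam` is no eigenvalue of the compact restriction, so `R - ρ
  -- lam` is bounded below on `W`. Eigenvectors for any `μ ≠ lam` lie in `W`, which keeps `ρ μ`,
  -- hence `μ`, away from `lam`.
  obtain ⟨C, hC⟩ := hRW.antilipschitz_of_not_hasEigenvalue (hρ0 lam) (by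
    intro h
    obtain ⟨x, hx⟩ := h.exists_hasEigenvector
    have hx1 : (x : E) ∈ opEigenspace D (lam : ℂ) := by
      have := eigenspace_resolvent_le_opEigenspace hR (hρ0 lam) (x := (x : E)) (by
        rw [Module.End.mem_eigenspace_iff]
        exact congrArg Subtype.val hx.apply_eq_smul)
      rwa [hρ, inv_inv, sub_add_cancel] at this
    exact hx.2 (Subtype.ext (inner_self_eq_zero.mp
      ((Submodule.mem_orthogonal _ _).mp x.2 x hx1))))
  refine ⟨(C + 1 : ℝ)⁻¹, by positivity, fun μ hμ hbot => ?_⟩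
  by_contra hμlam
  obtain ⟨x, hx, hx0⟩ := Submodule.exists_mem_ne_zero_of_ne_bot hbot
  have hxW : x ∈ W := by
    rw [hW, Submodule.mem_orthogonal]
    exact fun u hu => orthogonalFamily_opEigenspace hs (Ne.symm hμlam) ⟨u, hu⟩ ⟨x, hx⟩
  have hRx : R x = ρ μ • x := Module.End.mem_eigenspace_iff.mp
    (opEigenspace_le_eigenspace_resolvent hR (ofReal_ne_neg_I μ) hx)
  have h1 := hC.le_mul_dist ⟨x, hxW⟩ 0
  rw [map_zero, dist_zero_right, dist_zero_right] at h1
  have h2 : ((R.restrict hinv - ρ lam • 1 : W →L[ℂ] W) ⟨x, hxW⟩ : E) = (ρ μ - ρ lam) • x := by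
    change R x - ρ lam • x = _
    rw [hRx, sub_smul]
  have h3 : ‖ρ μ - ρ lam‖ ≤ |μ - lam| := by
    rw [hρ]
    dsimp only
    rw [inv_sub_inv (hne μ) (hne lam), norm_div, norm_mul, sub_sub_sub_cancel_right,
      ← Complex.ofReal_sub, Complex.norm_real, Real.norm_eq_abs, abs_sub_comm]
    exact div_le_self (abs_nonneg _) (one_le_mul_of_one_le_of_one_le (hone μ) (hone lam))
  have h4 : ‖x‖ ≤ C * (|μ - lam| * ‖x‖) := by
    calc ‖x‖ ≤ C * ‖(R.restrict hinv - ρ lam • 1 : W →L[ℂ] W) ⟨x, hxW⟩‖ := h1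
      _ = C * (‖ρ μ - ρ lam‖ * ‖x‖) := by rw [← norm_smul, ← h2]; rfl
      _ ≤ _ := by gcongr
  have hxpos : 0 < ‖x‖ := norm_pos_iff.mpr hx0
  have h5 : |μ - lam| * (C + 1) < 1 := by
    rwa [← lt_div_iff₀ (by positivity), one_div]
  have h6 : (C : ℝ) * |μ - lam| < 1 := by nlinarith [abs_nonneg (μ - lam)]
  nlinarith

end CompactResolvent

/-! ### Unitary groups and graph norms of spectral triples -/

namespace SpectralTriple

variable (T : SpectralTriple)

theorem isHilbertSum : IsHilbertSum ℂ (fun μ : ℝ => opEigenspace T.D μ)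
    fun μ => (opEigenspace T.D (μ : ℂ)).subtypeₗᵢ := by
  obtain ⟨R, hR, hc⟩ := T.compact_resolvent
  exact isHilbertSum_opEigenspace T.isSelfAdjoint hR hc

theorem norm_exp_I_mul_ofReal_mul_ofReal (t μ : ℝ) : ‖Complex.exp (Complex.I * t * μ)‖ = 1 := by
  rw [mul_assoc, ← Complex.ofReal_mul, Complex.norm_exp_I_mul_ofReal]

theorem summable_expI (t : ℝ) (x : T.H) : Summable fun μ : ℝ =>
    Complex.exp (Complex.I * t * μ) • (opEigenspace T.D μ).starProjection x :=
  summable_smul_starProjection T.isHilbertSum (norm_exp_I_mul_ofReal_mul_ofReal t) x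

theorem norm_expI (t : ℝ) (x : T.H) : ‖T.expI t x‖ = ‖x‖ :=
  norm_tsum_smul_starProjection T.isHilbertSum (norm_exp_I_mul_ofReal_mul_ofReal t) x

theorem expI_sub (t : ℝ) (x y : T.H) : T.expI t (x - y) = T.expI t x - T.expI t y := by
  rw [expI, expI, expI, ← (T.summable_expI t x).tsum_sub (T.summable_expI t y)]
  simp only [map_sub, smul_sub]

theorem expI_zero (x : T.H) : T.expI 0 x = x := by
  rw [expI]
  simpa using (hasSum_starProjection T.isHilbertSum x).tsum_eq

theorem expI_of_mem_opEigenspace (t : ℝ) {μ : ℝ} {x : T.H} (hx : x ∈ opEigenspace T.D μ) :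
    T.expI t x = Complex.exp (Complex.I * t * μ) • x := by
  rw [expI, tsum_eq_single μ fun ν hν => ?_, Submodule.starProjection_eq_self_iff.mpr hx]
  rw [starProjection_eq_zero_of_mem_of_ne T.isHilbertSum.OrthogonalFamily hν.symm hx, smul_zero]

/-- The weights `‖P_μ x‖²` form the spectral measure of `x`. Multiplying by `exp(-it lam)` recentres
it at `lam`, so the real part measures its concentration there. -/
theorem hasSum_inner_expI (t lam : ℝ) (x : T.H) :
    HasSum (fun μ : ℝ => Real.cos (t * (μ - lam)) * ‖(opEigenspace T.D μ).starProjection x‖ ^ 2)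
      (Complex.exp (-(Complex.I * t * lam)) * inner ℂ (T.expI (-t) x) x).re := by
  have h1 := (innerSL ℂ x).hasSum (T.summable_expI (-t) x).hasSum
  have h2 := Complex.hasSum_re
    (((Complex.hasSum_conj'.mpr h1).mul_left (Complex.exp (-(Complex.I * t * lam)))))
  convert h2 using 1
  · funext μ
    simp only [innerSL_apply_apply, inner_smul_right, inner_starProjection_self]
    rw [map_mul, ← Complex.exp_conj, Complex.conj_ofReal, ← mul_assoc, ← Complex.exp_add]
    have : -(Complex.I * t * lam) + (starRingEnd ℂ) (Complex.I * ((-t : ℝ) : ℂ) * μ) =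
        ((t * (μ - lam) : ℝ) : ℂ) * Complex.I := by
      simp only [map_mul, Complex.conj_I, Complex.conj_ofReal]
      push_cast
      ring
    rw [this, Complex.re_mul_ofReal, Complex.exp_ofReal_mul_I_re]
  · rw [innerSL_apply_apply, ← inner_conj_symm]
    rfl

/-- The integral is `2/r - sin(2s/r)/s`, and the second term is at most `1/r`. This makes every
frequency at distance at least `r` visible within time `2/r`. -/
theorem inv_le_integral_one_sub_cos {r s : ℝ} (hr : 0 < r) (hs : r ≤ |s|) :
    r⁻¹ ≤ ∫ t in (0 : ℝ)..2 / r, (1 - Real.cos (t * s)) := by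
  have hs0 : s ≠ 0 := by
    rintro rfl
    rw [abs_zero] at hs
    linarith
  rw [intervalIntegral.integral_sub (by simp) ((by fun_prop : Continuous _).intervalIntegrable _ _),
    intervalIntegral.integral_comp_mul_right (fun t => Real.cos t) hs0, integral_cos]
  simp only [intervalIntegral.integral_const, zero_mul, Real.sin_zero, sub_zero, smul_eq_mul,
    mul_one]
  have h1 : s⁻¹ * Real.sin (2 / r * s) ≤ r⁻¹ := by
    refine (le_abs_self _).trans ?_
    rw [abs_mul, abs_inv]
    calc |s|⁻¹ * |Real.sin (2 / r * s)| ≤ r⁻¹ * 1 := by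
          gcongr
          exact Real.abs_sin_le_one _
      _ = r⁻¹ := mul_one _
  have h2 : 2 / r = r⁻¹ + r⁻¹ := by ring
  linarith

/-- A vector whose orbit almost is the one of an eigenvector for `lam`, for a long enough time, has
a component in an eigenspace for an eigenvalue close to `lam`. -/
theorem exists_starProjection_ne_zero {lam r k : ℝ} (hr : 0 < r) {x : T.H}
    (h : ∀ t ∈ Set.Icc (0 : ℝ) (2 / r),
      ‖inner ℂ (T.expI (-t) x) x - Complex.exp (Complex.I * t * lam) * (‖x‖ : ℂ) ^ 2‖ ≤ k)
    (hk : 2 * k < ‖x‖ ^ 2) :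
    ∃ μ : ℝ, |μ - lam| < r ∧ (opEigenspace T.D (μ : ℂ)).starProjection x ≠ 0 := by
  by_contra! hcon
  set a : ℝ → ℝ := fun μ => ‖(opEigenspace T.D (μ : ℂ)).starProjection x‖ ^ 2 with ha
  have hsum : HasSum a (‖x‖ ^ 2) := hasSum_norm_sq_starProjection T.isHilbertSum x
  -- A finite set already carrying mass more than `2k`, so that only finite sums need to be
  -- integrated.
  obtain ⟨F, hF⟩ := (hsum.eventually (lt_mem_nhds hk)).exists
  have hbound : ∀ t ∈ Set.Icc (0 : ℝ) (2 / r),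
      ∑ μ ∈ F, (1 - Real.cos (t * (μ - lam))) * a μ ≤ k := by
    intro t ht
    have h1 := hsum.sub (T.hasSum_inner_expI t lam x)
    refine (sum_le_hasSum (f := fun μ => (1 - Real.cos (t * (μ - lam))) * a μ) F (fun μ _ =>
      mul_nonneg (sub_nonneg.mpr (Real.cos_le_one _)) (sq_nonneg _)) (h1.congr_fun ?_)).trans ?_
    · intro μ
      ring
    have h2 : (Complex.exp (-(Complex.I * t * lam)) * (Complex.exp (Complex.I * t * lam) *
        (‖x‖ : ℂ) ^ 2)).re = ‖x‖ ^ 2 := by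
      rw [← mul_assoc, ← Complex.exp_add, neg_add_cancel, Complex.exp_zero, one_mul,
        ← Complex.ofReal_pow, Complex.ofReal_re]
    rw [← h2, ← Complex.sub_re, ← mul_sub]
    refine (Complex.re_le_norm _).trans ?_
    rw [norm_mul, norm_sub_rev, show -(Complex.I * t * lam) = Complex.I * ((-t : ℝ) : ℂ) * lam by
      push_cast; ring, norm_exp_I_mul_ofReal_mul_ofReal, one_mul]
    exact h t ht
  have hr2 : (0 : ℝ) ≤ 2 / r := by positivity
  have h1 := intervalIntegral.integral_mono_on (μ := MeasureTheory.volume) hr2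
    ((by fun_prop : Continuous fun t : ℝ =>
      ∑ μ ∈ F, (1 - Real.cos (t * (μ - lam))) * a μ).intervalIntegrable _ _)
    (intervalIntegrable_const (c := k)) hbound
  rw [intervalIntegral.integral_finsetSum fun μ _ =>
    (by fun_prop : Continuous _).intervalIntegrable _ _] at h1
  simp only [intervalIntegral.integral_mul_const, intervalIntegral.integral_const, sub_zero,
    smul_eq_mul] at h1
  -- Eigenvalues closer than `r` have weight zero by `hcon`; the others are covered by the integral
  -- bound. Comparison with `(2/r)k` gives mass at most `2k` on `F`.
  have h2 : ∑ μ ∈ F, r⁻¹ * a μ ≤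
      ∑ μ ∈ F, (∫ t in (0 : ℝ)..2 / r, (1 - Real.cos (t * (μ - lam)))) * a μ := by
    refine Finset.sum_le_sum fun μ _ => ?_
    rcases lt_or_ge |μ - lam| r with hμ | hμ
    · simp [ha, hcon μ hμ]
    · exact mul_le_mul_of_nonneg_right (inv_le_integral_one_sub_cos hr hμ) (sq_nonneg _)
  rw [← Finset.mul_sum] at h2
  have h3 : r⁻¹ * ∑ μ ∈ F, a μ ≤ r⁻¹ * (2 * k) := by
    refine (h2.trans h1).trans_eq ?_
    ring
  exact absurd (le_of_mul_le_mul_left h3 (inv_pos.mpr hr)) (not_le.mpr hF)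

theorem graphNorm_of_mem_opEigenspace {μ : ℝ} {x : T.H} (hx : x ∈ opEigenspace T.D μ) :
    T.graphNorm x = ENNReal.ofReal ((1 + |μ|) * ‖x‖) := by
  obtain ⟨y, rfl, hy⟩ := mem_opEigenspace.mp hx
  rw [graphNorm, dif_pos y.2, Subtype.coe_eta, hy, ← ofReal_norm, ← ofReal_norm,
    ← ENNReal.ofReal_add (norm_nonneg _) (norm_nonneg _), norm_smul, Complex.norm_real,
    Real.norm_eq_abs]
  congr 1
  ring

theorem graphNorm_neg (x : T.H) : T.graphNorm (-x) = T.graphNorm x := by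
  have h (x : T.H) (hx : x ∈ T.D.domain) : T.graphNorm (-x) = T.graphNorm x := by
    have h1 : T.D ⟨-x, neg_mem hx⟩ = -T.D ⟨x, hx⟩ := T.D.map_neg ⟨x, hx⟩
    rw [graphNorm, graphNorm, dif_pos (neg_mem hx), dif_pos hx, h1, enorm_neg, enorm_neg]
  by_cases hx : x ∈ T.D.domain
  · exact h x hx
  · rw [graphNorm, graphNorm, dif_neg hx, dif_neg fun hx' => hx (neg_neg x ▸ neg_mem hx')]

theorem graphNorm_add_le (x y : T.H) : T.graphNorm (x + y) ≤ T.graphNorm x + T.graphNorm y := by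
  by_cases hx : x ∈ T.D.domain
  · by_cases hy : y ∈ T.D.domain
    · have h1 : T.D ⟨x + y, add_mem hx hy⟩ = T.D ⟨x, hx⟩ + T.D ⟨y, hy⟩ :=
        T.D.map_add ⟨x, hx⟩ ⟨y, hy⟩
      rw [graphNorm, graphNorm, graphNorm, dif_pos hx, dif_pos hy, dif_pos (add_mem hx hy), h1]
      calc _ ≤ (‖x‖ₑ + ‖y‖ₑ) + (‖T.D ⟨x, hx⟩‖ₑ + ‖T.D ⟨y, hy⟩‖ₑ) := by
            gcongr <;> exact enorm_add_le _ _
        _ = _ := by abel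
    · rw [graphNorm.eq_def T y, dif_neg hy, add_top]
      exact le_top
  · rw [graphNorm.eq_def T x, dif_neg hx, top_add]
    exact le_top

theorem graphNorm_smul (z : ℂ) {x : T.H} (hx : T.graphNorm x < ∞) :
    T.graphNorm (z • x) = ‖z‖ₑ * T.graphNorm x := by
  by_cases hx' : x ∈ T.D.domain
  · have h1 : T.D ⟨z • x, T.D.domain.smul_mem z hx'⟩ = z • T.D ⟨x, hx'⟩ :=
      T.D.map_smul z ⟨x, hx'⟩
    rw [graphNorm, graphNorm, dif_pos hx', dif_pos (T.D.domain.smul_mem z hx'), h1, enorm_smul,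
      enorm_smul, mul_add]
  · rw [graphNorm, dif_neg hx'] at hx
    exact absurd hx (lt_irrefl _)

theorem enorm_le_graphNorm (x : T.H) : ‖x‖ₑ ≤ T.graphNorm x := by
  rw [graphNorm]
  split_ifs with h
  · exact le_self_add
  · exact le_top

end SpectralTriple

/-! ### Characters as states -/

/-- A unital *-morphism to the complex numbers, as an element of the dual. -/
def characterDual {B : Type*} [CStarAlgebra B] (θ : B →⋆ₐ[ℂ] ℂ) : WeakDual ℂ B :=
  StrongDual.toWeakDual (⟨θ.toAlgHom.toLinearMap, map_continuous θ⟩ : B →L[ℂ] ℂ)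

theorem characterDual_apply {B : Type*} [CStarAlgebra B] (θ : B →⋆ₐ[ℂ] ℂ) (b : B) :
    characterDual θ b = θ b :=
  rfl

theorem characterDual_mem_stateSpace {B : Type*} [CStarAlgebra B] (θ : B →⋆ₐ[ℂ] ℂ) :
    characterDual θ ∈ stateSpace B := by
  refine ⟨map_one θ, fun a => ?_⟩
  rw [characterDual_apply, map_mul, map_star]
  exact star_mul_self_nonneg (θ a)

/-- The only state of `ℂ` is the identity, so the pulled-back states reduce to one point and the
extent bounds the distance of every state to it. -/
theorem eq_characterDual_of_mem_pulledStates {B : Type*} [CStarAlgebra B] {θ : B →⋆ₐ[ℂ] ℂ}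
    {χ : WeakDual ℂ B} (hχ : χ ∈ Tunnel.pulledStates θ) : χ = characterDual θ := by
  obtain ⟨φ, hφ, h⟩ := hχ
  refine DFunLike.ext _ _ fun b => ?_
  rw [h, characterDual_apply]
  calc φ (θ b) = φ (θ b • 1) := by rw [smul_eq_mul, mul_one]
    _ = θ b := by rw [map_smul, hφ.1, smul_eq_mul, mul_one]

theorem le_oneSidedHaus {X : Type*} {d : X → X → ℝ≥0∞} {A B : Set X} {x : X} (hx : x ∈ A) :
    ⨅ y ∈ B, d x y ≤ oneSidedHaus d A B :=
  le_iSup₂ (f := fun x (_ : x ∈ A) => ⨅ y ∈ B, d x y) x hx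

/-! ### Modular quantum isometries onto spectral triples -/

namespace ModularQuantumIsometry

theorem DN_onM_le {P Q : CorrData} (f : ModularQuantumIsometry P Q) (ω : P.M) :
    Q.DN (f.onM ω) ≤ P.DN ω := by
  rcases lt_or_ge (P.DN ω) ∞ with h | h
  · rw [f.DN_eq _ (f.map_dom_DN ω h)]
    exact sInf_le ⟨ω, h, rfl, rfl⟩
  · exact le_top.trans h

theorem exists_DN_lt {P Q : CorrData} (f : ModularQuantumIsometry P Q) {ξ : Q.M} {c : ℝ≥0∞}
    (h : Q.DN ξ < c) : ∃ ω, P.DN ω < c ∧ f.onM ω = ξ := by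
  have h1 := h
  rw [f.DN_eq ξ (h.trans_le le_top)] at h1
  obtain ⟨_, ⟨ω, _, hω, rfl⟩, hlt⟩ := sInf_lt_iff.mp h1
  exact ⟨ω, hlt, hω⟩

variable {P : CorrData} {T : SpectralTriple} (f : ModularQuantumIsometry P T.mcc)

/-- The module map of a modular quantum isometry onto a spectral triple. -/
def toHilbert : P.M →ₗ[ℂ] T.H := f.onM.toLinearMap

theorem graphNorm_toHilbert_le (ω : P.M) : T.graphNorm (f.toHilbert ω) ≤ P.DN ω := f.DN_onM_le ω

theorem exists_toHilbert_eq {ξ : T.H} {c : ℝ≥0∞} (h : T.graphNorm ξ < c) :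
    ∃ ω, P.DN ω < c ∧ f.toHilbert ω = ξ :=
  f.exists_DN_lt (ξ := ξ) h

theorem norm_toHilbert_le_one {ω : P.M} (hω : P.DN ω ≤ 1) : ‖f.toHilbert ω‖ ≤ 1 := by
  have h := ((T.enorm_le_graphNorm _).trans (f.graphNorm_toHilbert_le ω)).trans hω
  rw [← ofReal_norm] at h
  exact ENNReal.ofReal_le_one.mp h

/-- The morphism of the right algebras, with values in the complex numbers. -/
def toCharacter : P.B →⋆ₐ[ℂ] ℂ := f.onB

theorem toCharacter_ip (ω η : P.M) :
    f.toCharacter (P.ip ω η) = inner ℂ (f.toHilbert ω) (f.toHilbert η) :=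
  f.map_ip ω η

theorem mkDist_characterDual_le (θ : P.B →⋆ₐ[ℂ] ℂ) :
    mkDist P.S (characterDual θ) (characterDual f.toCharacter) ≤ Tunnel.extentAlong f := by
  refine le_trans ?_ ((le_max_right _ _).trans (le_max_right _ _))
  refine le_trans ?_ (le_oneSidedHaus (characterDual_mem_stateSpace θ))
  refine le_iInf₂ fun χ hχ => ?_
  rw [eq_characterDual_of_mem_pulledStates (θ := f.toCharacter) hχ]

end ModularQuantumIsometry

/-! ### Estimates for a tunnel -/

section Estimates

variable {F K G H : ℝ≥0} {T₁ T₂ : SpectralTriple} (τ : Tunnel F K G H T₁.mcc T₂.mcc)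

theorem Tunnel.extent_symm : τ.symm.extent = τ.extent := max_comm _ _

theorem norm_toCharacter_sub_le (hH : 0 < H) {ε : ℝ} (hε : 0 ≤ ε)
    (hext : τ.extent ≤ ENNReal.ofReal ε) {b : τ.P.B} (hb : τ.P.S b ≤ H) :
    ‖τ.proj₁.toCharacter b - τ.proj₂.toCharacter b‖ ≤ H * ε := by
  have h1 : mkDist τ.P.S (characterDual τ.proj₁.toCharacter)
      (characterDual τ.proj₂.toCharacter) ≤ ENNReal.ofReal ε :=
    ((τ.proj₂.mkDist_characterDual_le _).trans (le_max_right _ _)).trans hext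
  have h2 : τ.P.S (((H : ℝ)⁻¹) • b) ≤ 1 := by
    rw [τ.isMetrical.qcms_right.smul_eq, enorm_inv (by positivity)]
    rw [show ‖(H : ℝ)‖ₑ = (H : ℝ≥0∞) by simp [Real.enorm_eq_ofReal]]
    calc (H : ℝ≥0∞)⁻¹ * τ.P.S b ≤ (H : ℝ≥0∞)⁻¹ * H := by gcongr
      _ = 1 := ENNReal.inv_mul_cancel (by exact_mod_cast hH.ne') ENNReal.coe_ne_top
  have h3 := (le_iSup (fun x : {x : τ.P.B // τ.P.S x ≤ 1} =>
    ‖characterDual τ.proj₁.toCharacter x - characterDual τ.proj₂.toCharacter x‖ₑ) ⟨_, h2⟩).trans h1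
  rw [← ofReal_norm, ENNReal.ofReal_le_ofReal_iff hε] at h3
  simp only [characterDual_apply] at h3
  rw [← Complex.coe_smul, map_smul, map_smul, ← smul_sub, norm_smul, Complex.norm_real, norm_inv,
    Real.norm_of_nonneg H.coe_nonneg, inv_mul_le_iff₀ (by exact_mod_cast hH)] at h3
  exact h3

theorem norm_inner_toHilbert_sub_le (hH : 0 < H) {ε : ℝ} (hε : 0 ≤ ε)
    (hext : τ.extent ≤ ENNReal.ofReal ε) {ω η : τ.P.M} (hω : τ.P.DN ω ≤ 1) (hη : τ.P.DN η ≤ 1) :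
    ‖inner ℂ (τ.proj₁.toHilbert ω) (τ.proj₁.toHilbert η) -
      inner ℂ (τ.proj₂.toHilbert ω) (τ.proj₂.toHilbert η)‖ ≤ 2 * H * ε := by
  have h1 := τ.isMetrical.inner_leibniz ω η (hω.trans_lt ENNReal.one_lt_top)
    (hη.trans_lt ENNReal.one_lt_top)
  have h2 : (H : ℝ≥0∞) * τ.P.DN ω * τ.P.DN η ≤ H := by
    calc (H : ℝ≥0∞) * τ.P.DN ω * τ.P.DN η ≤ H * 1 * 1 := by gcongr
      _ = H := by rw [mul_one, mul_one]
  have h3 := norm_toCharacter_sub_le τ hH hε hext (((le_max_left _ _).trans h1).trans h2)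
  have h4 := norm_toCharacter_sub_le τ hH hε hext (((le_max_right _ _).trans h1).trans h2)
  rw [← ModularQuantumIsometry.toCharacter_ip, ← ModularQuantumIsometry.toCharacter_ip]
  set c := τ.P.ip ω η
  have h5 (f : τ.P.B →⋆ₐ[ℂ] ℂ) : f c = f (ℜ c : τ.P.B) + Complex.I * f (ℑ c : τ.P.B) := by
    conv_lhs => rw [← realPart_add_I_smul_imaginaryPart c]
    rw [map_add, map_smul, smul_eq_mul]
  rw [h5, h5 τ.proj₂.toCharacter]
  calc _ = ‖(τ.proj₁.toCharacter (ℜ c : τ.P.B) - τ.proj₂.toCharacter (ℜ c : τ.P.B)) +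
        Complex.I * (τ.proj₁.toCharacter (ℑ c : τ.P.B) - τ.proj₂.toCharacter (ℑ c : τ.P.B))‖ := by
        congr 1
        ring
    _ ≤ H * ε + H * ε := by
        refine (norm_add_le _ _).trans (add_le_add h3 ?_)
        rw [norm_mul, Complex.norm_I, one_mul]
        exact h4
    _ = 2 * H * ε := by ring

theorem exists_norm_inner_expI_sub_le {ε : ℝ} (hε : 0 ≤ ε) {ς : ℝ≥0 → ℝ≥0}
    (hreach : halfReach τ ε ς < ENNReal.ofReal ε) {ξ : T₁.H} (hξ : T₁.graphNorm ξ ≤ 1) :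
    ∃ η : T₂.H, T₂.graphNorm η ≤ 1 ∧ ∀ t : ℝ≥0, (t : ℝ) ≤ 1 / ε → ∀ ω, τ.P.DN ω ≤ 1 →
      ‖inner ℂ (T₁.expI (-t) ξ) (τ.proj₁.toHilbert ω) -
        inner ℂ (T₂.expI (-(ς t : ℝ)) η) (τ.proj₂.toHilbert ω)‖ ≤ ε := by
  -- The strict bound on the reach is what yields an actual `η`, although the infimum need not be
  -- attained.
  have h1 := (le_oneSidedHaus (d := mkFamilyDist τ.P.DN) (A := orbits T₁ τ.proj₁ ε id)
    (B := orbits T₂ τ.proj₂ ε ς) ⟨ξ, hξ, rfl⟩).trans_lt hreach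
  simp only [iInf_lt_iff] at h1
  obtain ⟨_, ⟨η, hη, rfl⟩, h1⟩ := h1
  refine ⟨η, hη, fun t ht ω hω => ?_⟩
  have h2 := ((le_iSup (fun x : {x : τ.P.M // τ.P.DN x ≤ 1} =>
    ‖orbit T₁ τ.proj₁ ε id ξ ⟨t, ht⟩ x - orbit T₂ τ.proj₂ ε ς η ⟨t, ht⟩ x‖ₑ) ⟨ω, hω⟩).trans
      (le_iSup (fun j => mkDist τ.P.DN (orbit T₁ τ.proj₁ ε id ξ j)
        (orbit T₂ τ.proj₂ ε ς η j)) ⟨t, ht⟩)).trans h1.le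
  rw [← ofReal_norm, ENNReal.ofReal_le_ofReal_iff hε] at h2
  exact h2

/-- The error in `norm_inner_expI_sub_exp_le`. -/
def orbitError (H : ℝ≥0) (B ε : ℝ) : ℝ :=
  √(4 * (2 * H + 1) * ε) + (1 + B + 2 * H) * ε

/-- A vector matching `ω` at time `0` must be close to the other image `y` of `ω`: both pair almost
equally with everything lifted, and `η - y` itself can be lifted and used as a test vector. -/
theorem norm_sub_toHilbert_le (hH : 0 < H) {ε : ℝ} (hε : 0 < ε)
    (hext : τ.extent ≤ ENNReal.ofReal ε) {ω : τ.P.M} (hω : τ.P.DN ω ≤ 1) {η : T₂.H}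
    (hη : T₂.graphNorm η ≤ 1)
    (h : ∀ ω', τ.P.DN ω' ≤ 1 → ‖inner ℂ (τ.proj₁.toHilbert ω) (τ.proj₁.toHilbert ω') -
      inner ℂ η (τ.proj₂.toHilbert ω')‖ ≤ ε) :
    ‖η - τ.proj₂.toHilbert ω‖ ≤ √(4 * (2 * H + 1) * ε) := by
  set y := τ.proj₂.toHilbert ω with hy
  have h1 : T₂.graphNorm (η - y) ≤ 2 := by
    rw [sub_eq_add_neg]
    refine (T₂.graphNorm_add_le _ _).trans ?_
    rw [T₂.graphNorm_neg, ← one_add_one_eq_two]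
    exact add_le_add hη ((τ.proj₂.graphNorm_toHilbert_le ω).trans hω)
  -- `η - y` has graph norm at most `2`; the factor `1/4` makes the norm strictly less than `1`, so
  -- that a lift in the unit ball exists without attaining the quotient infimum.
  have h2 : T₂.graphNorm (((4 : ℝ)⁻¹ : ℂ) • (η - y)) < 1 := by
    rw [T₂.graphNorm_smul _ (h1.trans_lt (by norm_num)), ← ofReal_norm]
    calc _ ≤ ENNReal.ofReal ‖((4 : ℝ)⁻¹ : ℂ)‖ * ENNReal.ofReal 2 := by
          gcongr
          simpa using h1
      _ < 1 := by
          rw [← ENNReal.ofReal_mul (norm_nonneg _), ENNReal.ofReal_lt_one]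
          norm_num
  obtain ⟨ω', hω', hω'y⟩ := τ.proj₂.exists_toHilbert_eq h2
  have h3 := h ω' hω'.le
  have h4 := norm_inner_toHilbert_sub_le τ hH hε.le hext hω hω'.le
  have h5 : ‖inner ℂ (η - y) (τ.proj₂.toHilbert ω')‖ ≤ (2 * H + 1) * ε := by
    rw [inner_sub_left]
    calc _ = ‖(inner ℂ (τ.proj₁.toHilbert ω) (τ.proj₁.toHilbert ω') -
          inner ℂ y (τ.proj₂.toHilbert ω')) - (inner ℂ (τ.proj₁.toHilbert ω)
          (τ.proj₁.toHilbert ω') - inner ℂ η (τ.proj₂.toHilbert ω'))‖ := by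
          congr 1
          ring
      _ ≤ 2 * H * ε + ε := (norm_sub_le _ _).trans (add_le_add h4 h3)
      _ = _ := by ring
  rw [hω'y, inner_smul_right, inner_self_eq_norm_sq_to_K, norm_mul, norm_pow] at h5
  have h6 : 4⁻¹ * ‖η - y‖ ^ 2 ≤ (2 * H + 1) * ε := by
    simpa using h5
  refine Real.le_sqrt_of_sq_le ?_
  linarith

/-- Four errors add up: the reach (`ε`), the replacement of `η` by the eigenvector `y` (the square
root), that of `ς t` by `t` in the phase (`Bε`), and that of `‖y‖²` by `‖x‖²` (`2Hε`). -/
theorem norm_inner_expI_sub_exp_le (hH : 0 < H) {ε : ℝ} (hε : 0 < ε)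
    (hext : τ.extent ≤ ENNReal.ofReal ε) {ς : ℝ≥0 → ℝ≥0} (hς0 : ς 0 = 0)
    (hς : ∀ t : ℝ≥0, (t : ℝ) ≤ 1 / ε → |(ς t : ℝ) - t| ≤ ε)
    (hreach : halfReach τ ε ς < ENNReal.ofReal ε) {lam B : ℝ} (hB : |lam| ≤ B) {ω : τ.P.M}
    (hω : τ.P.DN ω ≤ 1) (hlam : τ.proj₂.toHilbert ω ∈ opEigenspace T₂.D (lam : ℂ))
    {t : ℝ} (ht0 : 0 ≤ t) (ht : t ≤ 1 / ε) :
    ‖inner ℂ (T₁.expI (-t) (τ.proj₁.toHilbert ω)) (τ.proj₁.toHilbert ω) -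
      Complex.exp (Complex.I * t * lam) * (‖τ.proj₁.toHilbert ω‖ : ℂ) ^ 2‖ ≤
        orbitError H B ε := by
  lift t to ℝ≥0 using ht0
  obtain ⟨η, hη, h⟩ := exists_norm_inner_expI_sub_le τ hε.le hreach
    ((τ.proj₁.graphNorm_toHilbert_le ω).trans hω)
  -- Time `t = 0`, where `ς 0 = 0` makes both unitaries trivial.
  have hηy := norm_sub_toHilbert_le τ hH hε hext hω hη (fun ω' hω' => by
    have := h 0 (by rw [NNReal.coe_zero]; positivity) ω' hω'
    rwa [hς0, NNReal.coe_zero, neg_zero, T₁.expI_zero, T₂.expI_zero] at this)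
  have h1 := h t ht ω hω
  have h4 := norm_inner_toHilbert_sub_le τ hH hε.le hext hω hω
  have hy1 := τ.proj₂.norm_toHilbert_le_one hω
  set x := τ.proj₁.toHilbert ω
  set y := τ.proj₂.toHilbert ω
  set s : ℝ := ((ς t : ℝ≥0) : ℝ)
  have h2 : ‖inner ℂ (T₂.expI (-s) η) y - inner ℂ (T₂.expI (-s) y) y‖ ≤
      √(4 * (2 * H + 1) * ε) := by
    rw [← inner_sub_left, ← T₂.expI_sub]
    refine (norm_inner_le_norm _ _).trans ?_
    rw [T₂.norm_expI]
    calc _ ≤ ‖η - y‖ * 1 := by gcongr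
      _ ≤ _ := by rwa [mul_one]
  have h3 : inner ℂ (T₂.expI (-s) y) y = Complex.exp (Complex.I * s * lam) * inner ℂ y y := by
    rw [T₂.expI_of_mem_opEigenspace _ hlam, inner_smul_left, ← Complex.exp_conj]
    congr 2
    simp
  have h5 : ‖Complex.exp (Complex.I * s * lam) - Complex.exp (Complex.I * t * lam)‖ ≤ B * ε := by
    have h6 : Complex.exp (Complex.I * s * lam) - Complex.exp (Complex.I * t * lam) =
        Complex.exp (Complex.I * t * lam) *
          (Complex.exp (Complex.I * (((s - t) * lam : ℝ) : ℂ)) - 1) := by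
      rw [mul_sub, mul_one, ← Complex.exp_add]
      congr 2
      push_cast
      ring
    rw [h6, norm_mul, SpectralTriple.norm_exp_I_mul_ofReal_mul_ofReal, one_mul]
    refine (Real.norm_exp_I_mul_ofReal_sub_one_le).trans ?_
    rw [Real.norm_eq_abs, abs_mul, mul_comm]
    exact mul_le_mul hB (hς t ht) (abs_nonneg _) ((abs_nonneg _).trans hB)
  have h7 : ‖(inner ℂ y y : ℂ)‖ ≤ 1 := by
    rw [inner_self_eq_norm_sq_to_K, norm_pow]
    simpa using hy1
  have h8 : (‖x‖ : ℂ) ^ 2 = inner ℂ x x := (inner_self_eq_norm_sq_to_K x).symm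
  rw [h8]
  calc _ = ‖(inner ℂ (T₁.expI (-t) x) x - inner ℂ (T₂.expI (-s) η) y) +
        (inner ℂ (T₂.expI (-s) η) y - inner ℂ (T₂.expI (-s) y) y) +
        (Complex.exp (Complex.I * s * lam) - Complex.exp (Complex.I * t * lam)) * inner ℂ y y -
        Complex.exp (Complex.I * t * lam) * (inner ℂ x x - inner ℂ y y)‖ := by
        rw [h3]
        congr 1
        ring
    _ ≤ ε + √(4 * (2 * H + 1) * ε) + B * ε * 1 + 1 * (2 * H * ε) := by
        refine (norm_sub_le _ _).trans (add_le_add ((norm_add_le _ _).trans (add_le_add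
          ((norm_add_le _ _).trans (add_le_add h1 h2)) ?_)) ?_)
        · rw [norm_mul]
          exact mul_le_mul h5 h7 (norm_nonneg _) ((norm_nonneg _).trans h5)
        · rw [norm_mul, SpectralTriple.norm_exp_I_mul_ofReal_mul_ofReal]
          gcongr
    _ = orbitError H B ε := by
        rw [orbitError]
        ring

end Estimates

/-! ### Comparison of eigenspaces through a tunnel -/

section Comparison

variable {F K G H : ℝ≥0} {T₁ T₂ : SpectralTriple}

/-- The consequences of a bound on the magnitude that concern the orbits of the first triple. -/
structure IsHalfClose (τ : Tunnel F K G H T₁.mcc T₂.mcc) (ε : ℝ) (ς : ℝ≥0 → ℝ≥0) : Prop where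
  pos : 0 < ε
  extent_le : τ.extent ≤ ENNReal.ofReal ε
  map_zero : ς 0 = 0
  abs_sub_le : ∀ t : ℝ≥0, (t : ℝ) ≤ 1 / ε → |(ς t : ℝ) - t| ≤ ε
  halfReach_lt : halfReach τ ε ς < ENNReal.ofReal ε

theorem IsIsoIso.symm {ε : ℝ} {ς₁ ς₂ : ℝ≥0 → ℝ≥0} (h : IsIsoIso ε ς₁ ς₂) : IsIsoIso ε ς₂ ς₁ :=
  ⟨h.2.1, h.1, fun x y z hx hy hz => (h.2.2 x y z hx hy hz).symm⟩

theorem IsIsoIso.abs_sub_le {ε : ℝ} (hε : 0 < ε) {ς₁ ς₂ : ℝ≥0 → ℝ≥0} (h : IsIsoIso ε ς₁ ς₂)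
    (t : ℝ≥0) (ht : (t : ℝ) ≤ 1 / ε) : |(ς₁ t : ℝ) - t| ≤ ε := by
  have h0 : ((0 : ℝ≥0) : ℝ) ≤ 1 / ε := by
    rw [NNReal.coe_zero]
    positivity
  -- With `y = z = 0` the almost-isometry condition compares `ς₁ t` with `t`.
  have := (h.2.2 t 0 0 ht h0 h0).1.le
  rwa [h.1, h.2.1, NNReal.coe_zero, add_zero, sub_zero, add_zero, sub_zero,
    abs_of_nonneg (ς₁ t).coe_nonneg, abs_of_nonneg t.coe_nonneg] at this

/-- The bound on `ε₀` excludes the default value `√2 / 2` of the infimum, so that a genuine tunnel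
is found. -/
theorem exists_isHalfClose {ε₀ : ℝ} (hε₀ : ε₀ ≤ √2 / 2)
    (h : spectralPropinquity.{w} F K G H T₁ T₂ < ε₀) :
    ∃ ε < ε₀, ∃ (τ : Tunnel.{w, _, 0, _, _, 0, _} F K G H T₁.mcc T₂.mcc) (ς₁ ς₂ : ℝ≥0 → ℝ≥0),
      IsHalfClose τ ε ς₁ ∧ IsHalfClose τ.symm ε ς₂ := by
  obtain ⟨ε, hε, hlt⟩ := exists_lt_of_csInf_lt (Set.insert_nonempty _ _) h
  rcases hε with rfl | ⟨hε, τ, ς₁, ς₂, hς, hmag⟩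
  · exact absurd hlt (not_lt.mpr hε₀)
  rw [magnitude, reach, max_lt_iff, max_lt_iff] at hmag
  exact ⟨ε, hlt, τ, ς₁, ς₂, ⟨hε, hmag.1.le, hς.1, hς.abs_sub_le hε, hmag.2.1⟩,
    ⟨hε, τ.extent_symm.trans_le hmag.1.le, hς.2.1, hς.symm.abs_sub_le hε, hmag.2.2⟩⟩

theorem DN_sum_le {P : CorrData} (hP : P.IsMetrical F K G H) {ι : Type*} (s : Finset ι)
    (ω : ι → P.M) : P.DN (∑ i ∈ s, ω i) ≤ ∑ i ∈ s, P.DN (ω i) := by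
  classical
  induction s using Finset.induction_on with
  | empty =>
    have := hP.DN_smul 0 0
    rw [smul_zero, enorm_zero, zero_mul] at this
    rw [Finset.sum_empty, Finset.sum_empty, this]
  | insert i s hi ih =>
    rw [Finset.sum_insert hi, Finset.sum_insert hi]
    exact (hP.DN_add_le _ _).trans (add_le_add le_rfl ih)

/-- Lifts given by the quotient norm depend on no linear choice, so only an orthonormal basis is
lifted. Its vectors have graph norm `1 + |lam| < 2 + B`, and the triangle inequality costs a factor
equal to the multiplicity. -/
theorem exists_linear_lift (τ : Tunnel F K G H T₁.mcc T₂.mcc) {lam B : ℝ} (hB : |lam| ≤ B) :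
    ∃ Λ : opEigenspace T₂.D (lam : ℂ) →ₗ[ℂ] τ.P.M, (∀ v, τ.proj₂.toHilbert (Λ v) = v) ∧
      ∀ v, τ.P.DN (Λ v) ≤
        ENNReal.ofReal (multiplicity (lam : ℂ) T₂.D * (2 + B) * ‖v‖) := by
  have b := stdOrthonormalBasis ℂ (opEigenspace T₂.D (lam : ℂ))
  have hb (i) : ∃ ω, τ.P.DN ω < ENNReal.ofReal (2 + B) ∧
      τ.proj₂.toHilbert ω = (b i : T₂.H) := by
    refine τ.proj₂.exists_toHilbert_eq ?_
    rw [T₂.graphNorm_of_mem_opEigenspace (b i).2]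
    have : ‖(b i : T₂.H)‖ = 1 := b.orthonormal.1 i
    rw [this, mul_one]
    refine (ENNReal.ofReal_lt_ofReal_iff ?_).mpr ?_ <;> linarith [abs_nonneg lam]
  choose ω hω hωb using hb
  refine ⟨b.toBasis.constr ℂ ω, fun v => ?_, fun v => ?_⟩
  · have : τ.proj₂.toHilbert ∘ₗ b.toBasis.constr ℂ ω = Submodule.subtype _ := by
      refine b.toBasis.ext fun i => ?_
      rw [LinearMap.comp_apply, Module.Basis.constr_basis, hωb]
      simp
    exact LinearMap.congr_fun this v
  · rw [Module.Basis.constr_apply_fintype]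
    refine (DN_sum_le τ.isMetrical _ _).trans ?_
    calc _ ≤ ∑ _i : Fin (Module.finrank ℂ (opEigenspace T₂.D (lam : ℂ))),
          ENNReal.ofReal (‖v‖ * (2 + B)) := by
          refine Finset.sum_le_sum fun i _ => ?_
          rw [τ.isMetrical.DN_smul, ENNReal.ofReal_mul (norm_nonneg _), ← ofReal_norm]
          refine mul_le_mul' (ENNReal.ofReal_le_ofReal ?_) (hω i).le
          have : b.toBasis.equivFun v i = inner ℂ (b i) v := by
            rw [Module.Basis.equivFun_apply, b.coe_toBasis_repr_apply, b.repr_apply_apply]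
          rw [this]
          refine (norm_inner_le_norm _ _).trans_eq ?_
          rw [b.orthonormal.1 i, one_mul]
      _ = _ := by
          rw [Finset.sum_const, Finset.card_univ, Fintype.card_fin, nsmul_eq_mul,
            ← ENNReal.ofReal_natCast, ← ENNReal.ofReal_mul (Nat.cast_nonneg _)]
          congr 1
          rw [multiplicity]
          ring

/-- `ε` is small enough for the comparison of `d`-dimensional eigenspaces, for eigenvalues of
modulus at most `B`, up to `r`. -/
def IsSmallFor (H : ℝ≥0) (B r : ℝ) (d : ℕ) (ε : ℝ) : Prop :=
  2 * ε ≤ r ∧ 2 * orbitError H B ε + 2 * H * ε < (((d * (2 + B) + 1) ^ 2)⁻¹ : ℝ)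

theorem exists_forall_isSmallFor (H : ℝ≥0) {B r : ℝ} (hB : 0 ≤ B) (hr : 0 < r) (d : ℕ) :
    ∃ ε₀ > 0, ∀ ε, 0 < ε → ε < ε₀ → IsSmallFor H B r d ε := by
  have h1 : Continuous fun ε : ℝ => 2 * orbitError H B ε + 2 * H * ε := by
    unfold orbitError
    fun_prop
  have h2 : ∀ᶠ ε : ℝ in 𝓝 0, 2 * orbitError H B ε + 2 * H * ε <
      (((d * (2 + B) + 1) ^ 2)⁻¹ : ℝ) := by
    refine h1.continuousAt.eventually_lt continuousAt_const ?_
    simp only [orbitError, mul_zero, Real.sqrt_zero, add_zero]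
    positivity
  obtain ⟨c, hc, h⟩ := Metric.eventually_nhds_iff.mp h2
  refine ⟨min c (r / 2), by positivity, fun ε hε hε' => ⟨?_, h ?_⟩⟩
  · linarith [min_le_right c (r / 2)]
  · rw [Real.dist_eq, sub_zero, abs_of_pos hε]
    exact hε'.trans_le (min_le_left _ _)

/-- `μ` may depend on `v`; linearity of `Ψ` becomes useful once a single `μ` is possible. -/
theorem IsHalfClose.exists_linearMap {τ : Tunnel F K G H T₁.mcc T₂.mcc} {ε : ℝ} {ς : ℝ≥0 → ℝ≥0}
    (hτ : IsHalfClose τ ε ς) (hH : 0 < H) {lam B r : ℝ} (hB : |lam| ≤ B) (hr : 0 < r)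
    (hε : IsSmallFor H B r (multiplicity (lam : ℂ) T₂.D) ε) :
    ∃ Ψ : opEigenspace T₂.D (lam : ℂ) →ₗ[ℂ] T₁.H, ∀ v ≠ 0, ∃ μ : ℝ, |μ - lam| < r ∧
      (opEigenspace T₁.D (μ : ℂ)).starProjection (Ψ v) ≠ 0 := by
  have hε0 := hτ.pos
  obtain ⟨Λ, hΛ, hΛDN⟩ := exists_linear_lift τ hB
  refine ⟨τ.proj₁.toHilbert ∘ₗ Λ, fun v hv => ?_⟩
  obtain ⟨hεr, hε⟩ := hε
  have hB0 : 0 ≤ B := (abs_nonneg _).trans hB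
  set C : ℝ := multiplicity (lam : ℂ) T₂.D * (2 + B) + 1 with hC
  have hC0 : 0 < C := by positivity
  have hv0 : 0 < ‖v‖ := norm_pos_iff.mpr hv
  -- This scaling puts the lift of `u` in the unit ball while `‖u‖ = C⁻¹`. Hence `‖x‖² ≥ C⁻² - 2Hε`,
  -- which `IsSmallFor` keeps above twice the orbit error.
  set c : ℝ := (C * ‖v‖)⁻¹ with hc
  have hc0 : 0 < c := by positivity
  set u := (c : ℂ) • v with hu
  have hun : ‖u‖ = C⁻¹ := by
    rw [hu, norm_smul, Complex.norm_real, Real.norm_of_nonneg hc0.le, hc]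
    field_simp
  have huDN : τ.P.DN (Λ u) ≤ 1 := by
    refine (hΛDN u).trans (ENNReal.ofReal_le_one.mpr ?_)
    rw [hun, ← div_eq_mul_inv, div_le_one hC0]
    linarith
  set x := τ.proj₁.toHilbert (Λ u) with hx
  have hxn : (C ^ 2)⁻¹ - 2 * H * ε ≤ ‖x‖ ^ 2 := by
    have h1 := norm_inner_toHilbert_sub_le τ hH hε0.le hτ.extent_le huDN huDN
    rw [hΛ, ← hx, inner_self_eq_norm_sq_to_K, inner_self_eq_norm_sq_to_K,
      show ‖(u : T₂.H)‖ = C⁻¹ from hun] at h1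
    have h2 : ‖((‖x‖ ^ 2 - (C⁻¹) ^ 2 : ℝ) : ℂ)‖ ≤ 2 * H * ε := by
      convert h1 using 2
      push_cast
      rfl
    rw [Complex.norm_real, Real.norm_eq_abs, inv_pow] at h2
    linarith [(abs_le.mp h2).1]
  -- The condition `2ε ≤ r` ensures that the observation time `2/r` does not exceed `1/ε`.
  obtain ⟨μ, hμ, hμx⟩ := T₁.exists_starProjection_ne_zero (lam := lam) (k := orbitError H B ε) hr
    (x := x) (fun t ht => norm_inner_expI_sub_exp_le τ hH hε0 hτ.extent_le hτ.map_zero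
      hτ.abs_sub_le hτ.halfReach_lt hB huDN (by rw [hΛ]; exact u.2) ht.1 (ht.2.trans (by
        rw [div_le_div_iff₀ hr hε0]
        linarith))) (by linarith)
  refine ⟨μ, hμ, fun h => hμx ?_⟩
  rw [hx, hu, map_smul, map_smul, map_smul]
  rw [LinearMap.comp_apply] at h
  rw [h, smul_zero]

theorem IsHalfClose.exists_opEigenspace_ne_bot {τ : Tunnel F K G H T₁.mcc T₂.mcc} {ε : ℝ}
    {ς : ℝ≥0 → ℝ≥0} (hτ : IsHalfClose τ ε ς) (hH : 0 < H) {lam B r : ℝ} (hB : |lam| ≤ B)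
    (hr : 0 < r) (hε : IsSmallFor H B r (multiplicity (lam : ℂ) T₂.D) ε)
    (hlam : opEigenspace T₂.D (lam : ℂ) ≠ ⊥) :
    ∃ μ : ℝ, |μ - lam| < r ∧ opEigenspace T₁.D (μ : ℂ) ≠ ⊥ := by
  obtain ⟨Ψ, hΨ⟩ := hτ.exists_linearMap hH hB hr hε
  obtain ⟨x, hx, hx0⟩ := Submodule.exists_mem_ne_zero_of_ne_bot hlam
  obtain ⟨μ, hμ, h⟩ := hΨ ⟨x, hx⟩ fun h => hx0 (congrArg Subtype.val h)
  exact ⟨μ, hμ, fun hbot => h ((Submodule.eq_bot_iff _).mp hbot _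
    (Submodule.starProjection_apply_mem _ _))⟩

theorem IsHalfClose.multiplicity_le {τ : Tunnel F K G H T₁.mcc T₂.mcc} {ε : ℝ}
    {ς : ℝ≥0 → ℝ≥0} (hτ : IsHalfClose τ ε ς) (hH : 0 < H) {lam B r : ℝ} (hB : |lam| ≤ B)
    (hr : 0 < r) (hε : IsSmallFor H B r (multiplicity (lam : ℂ) T₂.D) ε) {lam' : ℝ}
    (hlam' : ∀ μ : ℝ, |μ - lam| < r → opEigenspace T₁.D (μ : ℂ) ≠ ⊥ → μ = lam') :
    multiplicity (lam : ℂ) T₂.D ≤ multiplicity (lam' : ℂ) T₁.D := by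
  obtain ⟨Ψ, hΨ⟩ := hτ.exists_linearMap hH hB hr hε
  refine LinearMap.finrank_le_finrank_of_injective
    (f := (opEigenspace T₁.D (lam' : ℂ)).orthogonalProjectionOnto.toLinearMap ∘ₗ Ψ) ?_
  rw [injective_iff_map_eq_zero]
  intro v hv
  by_contra hv0
  obtain ⟨μ, hμ, h⟩ := hΨ v hv0
  obtain rfl := hlam' μ hμ fun hbot => h ((Submodule.eq_bot_iff _).mp hbot _
    (Submodule.starProjection_apply_mem _ _))
  exact h (congrArg Subtype.val hv)

end Comparison

end SpectralPropinquity

end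

/-! ### Convergence of the multiplicities -/

theorem mainTheorem5
    (F K G H : NNReal) (hF : 1 ≤ F) (hG : 1 ≤ G) (hH : 2 ≤ H)
    (T : ℕ → SpectralPropinquity.SpectralTriple.{u, v})
    (Tinf : SpectralPropinquity.SpectralTriple.{u, v})
    (hT : ∀ n, (T n).IsMetric) (hTinf : Tinf.IsMetric)
    (hconv : Filter.Tendsto
      (fun n => SpectralPropinquity.spectralPropinquity.{w, u, v, u, v} F K G H (T n) Tinf)
      Filter.atTop (nhds 0))
    (lam : ℝ) (hlam : (lam : ℂ) ∈ SpectralPropinquity.opSpectrum Tinf.D)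
    (δ : ℝ) (hδ : 0 < δ) (N : ℕ) (lamSeq : ℕ → ℝ)
    (hisol : ∀ n, N ≤ n →
      {x : ℝ | (x : ℂ) ∈ SpectralPropinquity.opSpectrum (T n).D} ∩
        Set.Ioo (lam - δ) (lam + δ) = {lamSeq n})
    (hmult : ∃ m : ℕ, ∀ᶠ n in Filter.atTop,
      SpectralPropinquity.multiplicity (lamSeq n : ℂ) (T n).D = m) :
    Filter.Tendsto (fun n => SpectralPropinquity.multiplicity (lamSeq n : ℂ) (T n).D)
      Filter.atTop (nhds (SpectralPropinquity.multiplicity (lam : ℂ) Tinf.D)) := by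
  obtain ⟨m, hm⟩ := hmult
  have hH0 : 0 < H := lt_of_lt_of_le two_pos hH
  obtain ⟨R, hR, hc⟩ := Tinf.compact_resolvent
  have hbot := SpectralPropinquity.opEigenspace_ne_bot_of_mem_opSpectrum hR hc hlam
  obtain ⟨r₀, hr₀, hiso⟩ :=
    SpectralPropinquity.exists_isolating_opEigenspace Tinf.isSelfAdjoint hR hc lam
  -- `r ≤ δ` isolates `λ_n` for `D_n`. As `λ_n` will be within `r` of `lam`, an eigenvalue of `D_∞`
  -- within `r` of `λ_n` is within `2r ≤ r₀` of `lam`.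
  obtain ⟨r, hr, hrδ, hrr₀⟩ : ∃ r > 0, r ≤ δ ∧ r + r ≤ r₀ :=
    ⟨min δ (r₀ / 2), by positivity, min_le_left _ _, by linarith [min_le_right δ (r₀ / 2)]⟩
  obtain ⟨ε₁, hε₁, h₁⟩ := SpectralPropinquity.exists_forall_isSmallFor H (abs_nonneg lam) hr
    (SpectralPropinquity.multiplicity (lam : ℂ) Tinf.D)
  -- For the reverse tunnel the eigenspace has dimension `m` and the eigenvalues `λ_n` are bounded
  -- by `|lam| + r`, so one threshold serves all large `n`.
  obtain ⟨ε₂, hε₂, h₂⟩ := SpectralPropinquity.exists_forall_isSmallFor H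
    (add_nonneg (abs_nonneg lam) hr.le) hr m
  have hε₀ : 0 < min (min ε₁ ε₂) (√2 / 2) := by positivity
  refine tendsto_const_nhds.congr' ?_
  filter_upwards [hm, hconv.eventually (gt_mem_nhds hε₀), eventually_ge_atTop N]
    with n hmn hclose hn
  obtain ⟨ε, hε, τ, ς₁, ς₂, hτ, hτ'⟩ :=
    SpectralPropinquity.exists_isHalfClose (min_le_right _ _) hclose
  have hε' := hε.trans_le (min_le_left _ _)
  have hsmall := h₁ ε hτ.pos (hε'.trans_le (min_le_left _ _))
  have hsmall' := h₂ ε hτ.pos (hε'.trans_le (min_le_right _ _))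
  have hunique : ∀ μ : ℝ, |μ - lam| < r →
      SpectralPropinquity.opEigenspace (T n).D (μ : ℂ) ≠ ⊥ → μ = lamSeq n := by
    intro μ hμ hμbot
    have hmem : μ ∈ {x : ℝ | (x : ℂ) ∈ SpectralPropinquity.opSpectrum (T n).D} ∩
        Set.Ioo (lam - δ) (lam + δ) := by
      have := abs_lt.mp hμ
      exact ⟨SpectralPropinquity.mem_opSpectrum_of_opEigenspace_ne_bot hμbot,
        by linarith, by linarith⟩
    rwa [hisol n hn] at hmem
  obtain ⟨μ, hμ, hμbot⟩ := hτ.exists_opEigenspace_ne_bot hH0 le_rfl hr hsmall hbot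
  obtain rfl := hunique μ hμ hμbot
  refine le_antisymm (hτ.multiplicity_le hH0 le_rfl hr hsmall hunique) ?_
  refine hτ'.multiplicity_le hH0 (B := |lam| + r) ?_ hr (by rwa [hmn]) fun ν hν => hiso ν ?_
  · linarith [abs_sub_abs_le_abs_sub (lamSeq n) lam]
  · linarith [abs_sub_le ν (lamSeq n) lam]
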